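/- Let $n\ge 2$. Let $\mathrm{AdS}_n=\{x\in\mathbb R^{n+1} : -x_1^2-x_2^2+x_3^2+\dots+x_{n+1}^2=-1\}$ with the induced Lorentzian metric. It is conformally equivalent to $(\mathbb S^1\times\mathbb D^{n-1},-dt^2+ds^2)$, where $\mathbb S^1=\mathbb R/2\pi\mathbb Z$, $t$ is the argument of $x_1+ix_2$ (increasing towards the future), and $\mathbb D^{n-1}$ is the open upper hemisphere of the round unit sphere $\mathbb S^{n-1}$. Accordingly $\mathrm{AdS}_n\cup\partial\mathrm{AdS}_n=\mathbb S^1\times\overline{\mathbb D}{}^{n-1}$, with universal cover $\widetilde{\mathrm{AdS}}_n\cup\partial\widetilde{\mathrm{AdS}}_n=(\mathbb R\times\overline{\mathbb D}{}^{n-1},-dt^2+ds^2)$ and $\partial\widetilde{\mathrm{AdS}}_n=\mathbb R\times\mathbb S^{n-2}$. Let $\widetilde\Lambda\subset\partial\widetilde{\mathrm{AdS}}_n$ be an achronal topological $(n-2)$-sphere, that is, a subset homeomorphic to $\mathbb S^{n-2}$ no two points of which are joined by a timelike curve of $\partial\widetilde{\mathrm{AdS}}_n$, and let $\Lambda$ be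 its projection to $\partial\mathrm{AdS}_n$. Let $$\widetilde E(\widetilde\Lambda)=\bigl(\widetilde{\mathrm{AdS}}_n\cup\partial\widetilde{\mathrm{AdS}}_n\bigr)\setminus\bigl(J^-(\widetilde\Lambda)\cup J^+(\widetilde\Lambda)\bigr)$$ be its invisible domain, where $J^\pm$ denote the causal future and past in $\widetilde{\mathrm{AdS}}_n\cup\partial\widetilde{\mathrm{AdS}}_n$, and let the AdS regular domain $E(\Lambda)$ be the projection of $\widetilde E(\widetilde\Lambda)$, viewed as a subset of $\mathrm{AdS}_n$ with the metric and time orientation of $\mathrm{AdS}_n$. For $x\in E(\Lambda)$ let $\tau(x)\in[0,+\infty]$ (resp. $\widehat\tau(x)$) be the supremum of the Lorentzian lengths of the past-oriented (resp. future-oriented) causal curves in $E(\Lambda)$ starting at $x$. Then: 1. $E(\Lambda)$ has regular cosmological time: $\tau(x)<\infty$ for every $x\in E(\Lambda)$, and $\lim_{s\to\infty}\tau(c(s))=0$ for every past-oriented inextendible causal curve $c:[0,+\infty)\to E(\Lambda)$. 2. $E(\Lambda)$ has regular reverse cosmological time: $\widehat\tau(x)<\infty$ for every $x\in E(\Lambda)$,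 and $\lim_{s\to\infty}\widehat\tau(c(s))=0$ for every future-oriented inextendible causal curve $c:[0,+\infty)\to E(\Lambda)$. -/

import Mathlib

open MeasureTheory Set Filter Topology
open scoped ENNReal

noncomputable section

/-- A time-oriented space realised as a subset of a normed space `V`: the underlying set, the
metric as the quadratic form `v ↦ g_x(v, v)` on velocities at `x`, and a one-form that is positive
exactly on the future-oriented ones among the nonzero causal vectors. It is only used for the
three explicit spaces below. -/
structure EmbeddedSpacetime (V : Type*) where
  carrier : Set V
  metric : V → V → ℝ
  timeForm : V → V → ℝ

namespace EmbeddedSpacetime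

variable {V : Type*}

/-- `v` is a future-oriented (nonzero) causal vector at `x`. -/
def FutureCausal (M : EmbeddedSpacetime V) (x v : V) : Prop :=
  M.metric x v ≤ 0 ∧ 0 < M.timeForm x v

/-- `v` is a past-oriented (nonzero) causal vector at `x`. -/
def PastCausal (M : EmbeddedSpacetime V) (x v : V) : Prop :=
  M.metric x v ≤ 0 ∧ M.timeForm x v < 0

/-- `v` is a future-oriented timelike vector at `x`. -/
def FutureTimelike (M : EmbeddedSpacetime V) (x v : V) : Prop :=
  M.metric x v < 0 ∧ 0 < M.timeForm x v

variable [NormedAddCommGroup V] [NormedSpace ℝ V]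

/-- `c`, restricted to the interval `I`, is a locally Lipschitz curve in `M` whose velocity
satisfies the condition `C` (future causal, past causal, future timelike) almost everywhere.
This contains all piecewise `C¹` curves with velocities in `C`, and, up to reparametrisation,
all continuous causal curves. -/
structure IsCurve (M : EmbeddedSpacetime V) (C : V → V → Prop) (I : Set ℝ) (c : ℝ → V) :
    Prop where
  ordConnected : I.OrdConnected
  mapsTo : MapsTo c I M.carrier
  locallyLipschitz : LocallyLipschitzOn I c
  velocity : ∀ᵐ s ∂(volume.restrict I), C (c s) (derivWithin c I s)

/-- There is a curve in `M` with velocities in `C` that goes from `p` to `q`. -/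
def Joined (M : EmbeddedSpacetime V) (C : V → V → Prop) (p q : V) : Prop :=
  ∃ (a b : ℝ) (c : ℝ → V), a < b ∧ M.IsCurve C (Icc a b) c ∧ c a = p ∧ c b = q

/-- The causal future `J⁺(S)`. -/
def causalFuture (M : EmbeddedSpacetime V) (S : Set V) : Set V :=
  {q | q ∈ M.carrier ∧ ∃ p ∈ S, p = q ∨ M.Joined M.FutureCausal p q}

/-- The causal past `J⁻(S)`. -/
def causalPast (M : EmbeddedSpacetime V) (S : Set V) : Set V :=
  {q | q ∈ M.carrier ∧ ∃ p ∈ S, q = p ∨ M.Joined M.FutureCausal q p}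

/-- `S` is an achronal subset of `M`: no timelike curve of `M` joins two points of `S`. -/
def IsAchronal (M : EmbeddedSpacetime V) (S : Set V) : Prop :=
  S ⊆ M.carrier ∧ ∀ p ∈ S, ∀ q ∈ S, ¬ M.Joined M.FutureTimelike p q

/-- The Lorentzian length `∫_I √(-g(c', c'))`. -/
def length (M : EmbeddedSpacetime V) (I : Set ℝ) (c : ℝ → V) : ℝ≥0∞ :=
  ∫⁻ s in I, ENNReal.ofReal (√(-M.metric (c s) (derivWithin c I s)))

/-- The curves with velocities in `C` that start at `x`: they are parametrised by an interval
`[0, b]`, `[0, b)` or `[0, +∞)`. -/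
def curvesFrom (M : EmbeddedSpacetime V) (C : V → V → Prop) (x : V) : Set (Set ℝ × (ℝ → V)) :=
  {γ | IsLeast γ.1 0 ∧ M.IsCurve C γ.1 γ.2 ∧ γ.2 0 = x}

/-- The cosmological time: the supremum of the lengths of the past-oriented causal curves
starting at `x`. -/
def cosmologicalTime (M : EmbeddedSpacetime V) (x : V) : ℝ≥0∞ :=
  ⨆ γ ∈ M.curvesFrom M.PastCausal x, M.length γ.1 γ.2

/-- The reverse cosmological time: the supremum of the lengths of the future-oriented causal
curves starting at `x`. -/
def reverseCosmologicalTime (M : EmbeddedSpacetime V) (x : V) : ℝ≥0∞ :=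
  ⨆ γ ∈ M.curvesFrom M.FutureCausal x, M.length γ.1 γ.2

/-- `c : [0, +∞) → M` is an inextendible curve with velocities in `C`: it has no endpoint in
`M`. -/
def IsInextendible (M : EmbeddedSpacetime V) (C : V → V → Prop) (c : ℝ → V) : Prop :=
  M.IsCurve C (Ici 0) c ∧ ¬ ∃ y ∈ M.carrier, Tendsto c atTop (𝓝 y)

/-- The cosmological time is finite, and it tends to `0` along every past-oriented inextendible
causal curve. -/
def HasRegularCosmologicalTime (M : EmbeddedSpacetime V) : Prop :=
  (∀ x ∈ M.carrier, M.cosmologicalTime x < ∞) ∧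
    ∀ c : ℝ → V, M.IsInextendible M.PastCausal c →
      Tendsto (fun s => M.cosmologicalTime (c s)) atTop (𝓝 0)

/-- The reverse cosmological time is finite, and it tends to `0` along every future-oriented
inextendible causal curve. -/
def HasRegularReverseCosmologicalTime (M : EmbeddedSpacetime V) : Prop :=
  (∀ x ∈ M.carrier, M.reverseCosmologicalTime x < ∞) ∧
    ∀ c : ℝ → V, M.IsInextendible M.FutureCausal c →
      Tendsto (fun s => M.reverseCosmologicalTime (c s)) atTop (𝓝 0)

end EmbeddedSpacetime

namespace AdS

/-- The Euclidean space `ℝⁿ⁻¹`. -/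
abbrev Euc (n : ℕ) : Type := EuclideanSpace ℝ (Fin (n - 1))

/-- `ℝⁿ⁺¹ = ℝ² × ℝⁿ⁻¹`: a point `(x₁, …, x_{n+1})` is written `(z, y)` with `z = x₁ + i x₂` and
`y = (x₃, …, x_{n+1})`. -/
abbrev Ambient (n : ℕ) : Type := ℂ × Euc n

/-- The ambient space `ℝ × ℝⁿ` of `ℝ × 𝕊ⁿ⁻¹`: a point is `(t, h, y)`, where `(h, y)` are the
height and the horizontal part of a point of `ℝⁿ = ℝ × ℝⁿ⁻¹`. -/
abbrev CoverAmbient (n : ℕ) : Type := ℝ × ℝ × Euc n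

/-- The quadratic form `-x₁² - x₂² + x₃² + ⋯ + x_{n+1}²`. -/
def Q (n : ℕ) (x : Ambient n) : ℝ := -(x.1.re ^ 2) - x.1.im ^ 2 + ∑ i, x.2 i ^ 2

/-- The anti-de Sitter space `AdS_n = {Q = -1}`. -/
def quadric (n : ℕ) : Set (Ambient n) := {x | Q n x = -1}

/-- The metric `-dt² + ds²` on `ℝ × ℝⁿ`; on `ℝ × 𝕊ⁿ⁻¹` it induces `-dt²` plus the round metric
of curvature `1`. -/
def productMetric (n : ℕ) (_ v : CoverAmbient n) : ℝ := -(v.1 ^ 2) + (v.2.1 ^ 2 + ‖v.2.2‖ ^ 2)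

/-- The universal cover of `AdS_n ∪ ∂AdS_n`: the product of `ℝ` and the closed upper hemisphere
of `𝕊ⁿ⁻¹`, with `-dt² + ds²`, where `t` increases to the future. -/
def coverClosure (n : ℕ) : EmbeddedSpacetime (CoverAmbient n) where
  carrier := {x | 0 ≤ x.2.1 ∧ x.2.1 ^ 2 + ‖x.2.2‖ ^ 2 = 1}
  metric := productMetric n
  timeForm := fun _ v => v.1

/-- The universal cover of `∂AdS_n`: the product of `ℝ` and the equator `𝕊ⁿ⁻²`, with
`-dt² + ds²`. -/
def coverBoundary (n : ℕ) : EmbeddedSpacetime (CoverAmbient n) where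
  carrier := {x | x.2.1 = 0 ∧ ‖x.2.2‖ = 1}
  metric := productMetric n
  timeForm := fun _ v => v.1

/-- An achronal topological `(n-2)`-sphere in the universal cover of `∂AdS_n`. -/
def IsAchronalSphere (n : ℕ) (L : Set (CoverAmbient n)) : Prop :=
  (coverBoundary n).IsAchronal L ∧ Nonempty (L ≃ₜ Metric.sphere (0 : Euc n) 1)

/-- The invisible domain: the points of the universal cover of `AdS_n ∪ ∂AdS_n` that are not
causally related to any point of `L`. -/
def invisibleDomain (n : ℕ) (L : Set (CoverAmbient n)) : Set (CoverAmbient n) :=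
  (coverClosure n).carrier \ ((coverClosure n).causalPast L ∪ (coverClosure n).causalFuture L)

/-- The covering projection from `ℝ` times the closed hemisphere to `𝕊¹ = ℝ / 2πℤ` times the
closed hemisphere, with `𝕊¹` seen as the unit circle of `ℂ`. -/
def coverProj (n : ℕ) (x : CoverAmbient n) : ℂ × ℝ × Euc n :=
  (Complex.exp (x.1 * Complex.I), x.2)

/-- The conformal diffeomorphism from `AdS_n` onto `𝕊¹` times the open upper hemisphere. Its
inverse is `(e^{it}, h, y) ↦ (e^{it} / h, y / h)`, and it identifies the metric of `AdS_n` with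
`h⁻² (-dt² + ds²)`. -/
def conformalMap (n : ℕ) (x : Ambient n) : ℂ × ℝ × Euc n :=
  (x.1 / (‖x.1‖ : ℂ), ‖x.1‖⁻¹, ‖x.1‖⁻¹ • x.2)

/-- The AdS regular domain `E(Λ)` of the projection `Λ` of `L`, seen as a subset of `AdS_n` and
endowed with the metric induced by `Q`, the future being the direction in which `t = arg z`
increases (`Im (z̄ dz) = |z|² dt`). -/
def regularDomain (n : ℕ) (L : Set (CoverAmbient n)) : EmbeddedSpacetime (Ambient n) where
  carrier := {x | x ∈ quadric n ∧ conformalMap n x ∈ coverProj n '' invisibleDomain n L}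
  metric := fun _ v => Q n v
  timeForm := fun x v => (starRingEnd ℂ x.1 * v.1).im

end AdS

end

/-!
All causal curves are studied in the universal cover `ℝ × hemisphere`, with `T` the time coordinate
and, for `p` in the achronal sphere `L`, with `D_p` the spherical distance to `p`.

*The sphere is a graph over the equator.* Vertical segments of the boundary are timelike, so that
`L` projects injectively to the equator `𝕊ⁿ⁻²`. The projection is onto, because a sphere does not
embed in a proper subset of itself (`eq_sphere_of_homeomorph`). This is deduced from Brouwer's
theorem (`exists_zero_of_contDiff_of_eq_id`), proved by the volume argument of Milnor and Rogers.
Surjectivity is essential: over an arc of the equator that `L` missed, curves of infinite length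
could escape to the boundary.

*The invisible domain.* A causal curve satisfies `|ΔD_p| ≤ |ΔT|`
(`antitoneOn_signed_time_add_sphereDist`), and meridians from `p` are extremal, so an interior point
is invisible from `L` if and only if `|T - T(p)| < D_p` for all `p ∈ L` (`mem_invisibleDomain_iff`).
As `D_p < π` in the interior, the argument of `z e^{-iT(p₀)}` for a fixed `p₀ ∈ L` lifts the
regular domain to the invisible domain, and the metric of `AdS_n` becomes `h⁻² (-dt² + ds²)`, with
`h` the height in the hemisphere (`exists_hasDerivAt_lift`).

*The length bound.* Let `σ = 1` for past curves and `σ = -1` for future curves, and put `S = σ T`.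
Both `U_p = S + D_p - σ T(p) > 0` and `V_p = S - D_p - σ T(p) < 0` decrease along such a curve.
Since `L` is compact, `V_p ≤ -η` for all `p` at the initial point, hence along the curve, where therefore
`2 D_p ≥ η` for all `p`. As `L` is a graph over the whole equator, this bounds the height below by
`sin (η / 2)`. The length element is then at most a multiple of
`√(S'² - D_p'²) = √((-U_p') (D_p' - S'))`, and the inequality of the means bounds the length by a
multiple of `ε⁻¹ U_p + 4 π ε`, where `U_p` is taken at the initial point and `ε > 0` and `p` are
arbitrary (`length_le`). In particular it is finite.

*The limit.* An inextendible curve of the regular domain has an endpoint in the cover, at positive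
height. This endpoint is not in the invisible domain, while `V_p ≤ -η` there, so `U_p` tends to `0`
along the curve for some `p ∈ L`, and the length bound tends to `0` (`regular_of_signedCausal`).
-/

noncomputable section

/-! ### Spheres do not embed in proper subsets of themselves -/

section Topology

/-- A map which is Lipschitz on a closed ball and vanishes on its boundary sphere is Lipschitz
once it is extended by zero. -/
lemma LipschitzOnWith.indicator_closedBall {E : Type*} [NormedAddCommGroup E]
    [NormedSpace ℝ E] {g : E → E} {R : ℝ} {K : NNReal}
    (hg : LipschitzOnWith K g (Metric.closedBall 0 R)) (h0 : ∀ x, ‖x‖ = R → g x = 0) :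
    LipschitzWith K ((Metric.closedBall 0 R).indicator g) := by
  have key : ∀ x y : E, ‖x‖ ≤ R → R < ‖y‖ → ‖g x‖ ≤ K * ‖x - y‖ := by
    intro x y hx hy
    obtain ⟨z, hz, hzR⟩ := (convex_segment x y).isPreconnected.intermediate_value
      (left_mem_segment ℝ x y) (right_mem_segment ℝ x y) continuous_norm.continuousOn
      (show R ∈ Icc _ _ from ⟨hx, hy.le⟩)
    have h1 := hg.dist_le_mul x (by simpa using hx) z (by simpa using hzR.le)
    rw [h0 z hzR, dist_zero_right] at h1
    have h2 : dist x z ≤ dist x y := by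
      have := dist_add_dist_of_mem_segment hz
      linarith [dist_nonneg (x := z) (y := y)]
    rw [← dist_eq_norm]
    exact h1.trans (by gcongr)
  refine LipschitzWith.of_dist_le_mul fun x y => ?_
  by_cases hx : x ∈ Metric.closedBall (0 : E) R <;> by_cases hy : y ∈ Metric.closedBall (0 : E) R
  · simpa [hx, hy] using hg.dist_le_mul x hx y hy
  · rw [indicator_of_mem hx, indicator_of_notMem hy, dist_zero_right, dist_eq_norm]
    exact key x y (by simpa using hx) (by simpa using hy)
  · rw [indicator_of_mem hy, indicator_of_notMem hx, dist_zero_left, dist_eq_norm, norm_sub_rev]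
    exact key y x (by simpa using hy) (by simpa using hx)
  · simp only [indicator_of_notMem hx, indicator_of_notMem hy, dist_self]
    positivity

variable {E : Type*} [NormedAddCommGroup E] [InnerProductSpace ℝ E] [FiniteDimensional ℝ E]

/-- For fixed `A`, the determinant of `1 + t A` is a polynomial in `t`. The degree bound does not
depend on `A`, so one interpolation formula in `t` serves all `A`. -/
lemma exists_polynomial_det_one_add_smul (A : E →L[ℝ] E) :
    ∃ p : Polynomial ℝ, p.natDegree ≤ Module.finrank ℝ E ∧
      ∀ t : ℝ, p.eval t = (1 + t • A : E →L[ℝ] E).det := by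
  let b := Module.finBasis ℝ E
  let M : Matrix (Fin (Module.finrank ℝ E)) (Fin (Module.finrank ℝ E)) ℝ :=
    LinearMap.toMatrix b b (A : E →ₗ[ℝ] E)
  refine ⟨((Polynomial.X : Polynomial ℝ) • M.map (Polynomial.C : ℝ → Polynomial ℝ) +
    (1 : Matrix (Fin (Module.finrank ℝ E)) (Fin (Module.finrank ℝ E)) ℝ).map
      (Polynomial.C : ℝ → Polynomial ℝ)).det, ?_, fun t => ?_⟩
  · simpa using Polynomial.natDegree_det_X_add_C_le M 1
  · have h : (1 + t • A : E →L[ℝ] E).det =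
        LinearMap.det (1 + t • (A : E →ₗ[ℝ] E)) := rfl
    rw [h, ← LinearMap.det_toMatrix b]
    rw [← Polynomial.coe_evalRingHom, RingHom.map_det]
    congr 1
    ext i j
    simp [M, LinearMap.toMatrix_one, Matrix.one_apply]
    split_ifs <;> simp <;> ring

/-- A continuous linear map at distance less than `1` from the identity preserves orientation. -/
lemma det_one_add_pos {A : E →L[ℝ] E} (hA : ‖A‖ < 1) : 0 < (1 + A : E →L[ℝ] E).det := by
  have hne : ∀ s ∈ Icc (0 : ℝ) 1, (1 + s • A : E →L[ℝ] E).det ≠ 0 := by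
    intro s hs h0
    have hunit : IsUnit (1 + s • A : E →L[ℝ] E) := by
      have hn : ‖-(s • A)‖ < 1 := by
        rw [norm_neg, norm_smul, Real.norm_of_nonneg hs.1]
        nlinarith [hs.2, norm_nonneg A, hs.1]
      simpa using isUnit_one_sub_of_norm_lt_one hn
    have h1 : IsUnit (((1 + s • A : E →L[ℝ] E) : E →ₗ[ℝ] E)) :=
      hunit.map (ContinuousLinearMap.toLinearMapRingHom : (E →L[ℝ] E) →+* (E →ₗ[ℝ] E))
    exact (LinearMap.isUnit_iff_isUnit_det _).1 h1 |>.ne_zero h0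
  have hc : Continuous fun s : ℝ => (1 + s • A : E →L[ℝ] E).det :=
    ContinuousLinearMap.continuous_det.comp (by fun_prop)
  by_contra! hneg
  have h0 : (1 + (0 : ℝ) • A : E →L[ℝ] E).det = 1 := by
    simp [ContinuousLinearMap.det]
  obtain ⟨s, hs, hs0⟩ := intermediate_value_Icc' (zero_le_one (α := ℝ)) hc.continuousOn
    (show (0 : ℝ) ∈ Icc _ _ from ⟨by simpa using hneg, by rw [h0]; exact zero_le_one⟩)
  exact hne s hs hs0

/-- A small perturbation of the identity that is supported in a ball permutes that ball. -/
lemma image_closedBall_add_of_lipschitz {u : E → E} {R : ℝ} {K : NNReal} (hK : K < 1)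
    (hu : LipschitzWith K u) (h0 : ∀ x, R < ‖x‖ → u x = 0) :
    Function.Injective (fun x => x + u x) ∧
      (fun x => x + u x) '' Metric.closedBall 0 R = Metric.closedBall 0 R := by
  have happ : ApproximatesLinearOn (fun x => x + u x)
      ((ContinuousLinearEquiv.refl ℝ E : E ≃L[ℝ] E) : E →L[ℝ] E) univ K := by
    apply LipschitzOnWith.approximatesLinearOn
    rw [lipschitzOnWith_univ]
    convert hu using 1
    ext x
    simp
  have hc : Subsingleton E ∨ K < ‖((ContinuousLinearEquiv.refl ℝ E).symm : E →L[ℝ] E)‖₊⁻¹ := by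
    rcases subsingleton_or_nontrivial E with h | h
    · exact Or.inl h
    · right
      have : ‖((ContinuousLinearEquiv.refl ℝ E).symm : E →L[ℝ] E)‖₊ = 1 := by
        simp
      rw [this]; simpa using hK
  have hinj : Function.Injective (fun x => x + u x) := (happ.toHomeomorph _ hc).injective
  have hsurj : Function.Surjective (fun x => x + u x) := (happ.toHomeomorph _ hc).surjective
  refine ⟨hinj, Subset.antisymm ?_ ?_⟩
  · rintro _ ⟨x, hx, rfl⟩
    by_contra hy
    have hy' : R < ‖x + u x‖ := by simpa using hy
    have : x + u x = x := hinj (by simp [h0 _ hy'])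
    exact hy (by simpa only [this] using hx)
  · intro y hy
    obtain ⟨x, rfl⟩ := hsurj y
    refine ⟨x, ?_, rfl⟩
    by_contra hx
    have := h0 x (by simpa using hx)
    simp only [this, add_zero] at hy
    exact hx hy

/-- Brouwer's theorem in its smooth form: a `C¹` map that is the identity outside a ball has a zero.
Otherwise `f = R H / |H|` is a retraction of the ball onto its boundary. For small `t` the map
`x ↦ x + t (f x - x)` permutes the ball, so that the integral of its Jacobian is the volume of the
ball; this integral is a polynomial in `t`, so the same holds for `t = 1`, where the Jacobian
vanishes. -/
lemma exists_zero_of_contDiff_of_eq_id {H : E → E} {R : ℝ} (hR : 0 < R) (hH : ContDiff ℝ 1 H)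
    (hid : ∀ x, R ≤ ‖x‖ → H x = x) : ∃ x, H x = 0 := by
  by_contra! hne
  borelize E
  let μ : Measure E := Measure.addHaar
  set B : Set E := Metric.closedBall 0 R with hB
  have hBc : IsCompact B := isCompact_closedBall _ _
  let f : E → E := fun x => (R * ‖H x‖⁻¹) • H x
  have hf : ContDiff ℝ 1 f :=
    (contDiff_const.mul ((hH.norm ℝ hne).inv fun x => (norm_ne_zero_iff.2 (hne x)))).smul hH
  have hfR : ∀ x, inner ℝ (f x) (f x) = R ^ 2 := by
    intro x
    rw [real_inner_self_eq_norm_sq, norm_smul, norm_mul, norm_inv, norm_norm, mul_assoc,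
      inv_mul_cancel₀ (norm_ne_zero_iff.2 (hne x)), mul_one, Real.norm_of_nonneg hR.le]
  have hfid : ∀ x, ‖x‖ = R → f x = x := by
    intro x hx
    simp only [f, hid x hx.ge, hx]
    rw [mul_inv_cancel₀ hR.ne', one_smul]
  have hfd : ∀ x, HasFDerivAt f (fderiv ℝ f x) x := fun x =>
    (hf.differentiable one_ne_zero x).hasFDerivAt
  -- the image of the derivative of `f` at `x` is orthogonal to `f x`
  have hdet : ∀ x, (fderiv ℝ f x).det = 0 := by
    intro x
    by_contra h0
    have hu : IsUnit ((fderiv ℝ f x : E →L[ℝ] E) : E →ₗ[ℝ] E) :=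
      (LinearMap.isUnit_iff_isUnit_det _).2 (isUnit_iff_ne_zero.2 h0)
    obtain ⟨v, hv⟩ := (LinearMap.isUnit_iff_range_eq_top _).1 hu |> LinearMap.range_eq_top.1 <| f x
    have h1 : HasFDerivAt (fun x => inner ℝ (f x) (f x)) (0 : E →L[ℝ] ℝ) x := by
      simp only [hfR]; exact hasFDerivAt_const _ _
    have h2 := congrArg (fun L : E →L[ℝ] ℝ => L v) (((hfd x).inner ℝ (hfd x)).unique h1)
    have hv' : fderiv ℝ f x v = f x := hv
    simp only [ContinuousLinearMap.comp_apply, ContinuousLinearMap.prod_apply,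
      fderivInnerCLM_apply, hv', hfR, zero_apply] at h2
    nlinarith
  let A : E → E →L[ℝ] E := fun x => fderiv ℝ f x - 1
  have hA : Continuous A := (hf.continuous_fderiv one_ne_zero).sub continuous_const
  obtain ⟨K₁, hK₁⟩ := ContDiffOn.exists_lipschitzOnWith (hf.sub contDiff_id).contDiffOn one_ne_zero
    (convex_closedBall (0 : E) R) hBc
  obtain ⟨K₂, hK₂⟩ := hBc.exists_bound_of_continuousOn hA.continuousOn
  have hu := hK₁.indicator_closedBall (fun x hx => by simp [hfid x hx])
  set u := (Metric.closedBall 0 R).indicator (f - id) with hu_def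
  -- the volume identity for small parameters
  have hsmall : ∀ t : ℝ, 0 < t → t * (K₁ + |K₂| + 1) < 1 →
      ∫ x in B, (1 + t • A x : E →L[ℝ] E).det ∂μ = μ.real B := by
    intro t ht htK
    let tt : NNReal := ⟨t, ht.le⟩
    have hK1 : tt * K₁ < 1 := by
      rw [← NNReal.coe_lt_coe]
      change t * K₁ < 1
      nlinarith [abs_nonneg K₂]
    have hut : LipschitzWith (tt * K₁) (fun x => t • u x) := by
      refine LipschitzWith.of_dist_le_mul fun x y => ?_
      rw [dist_smul₀, Real.norm_of_nonneg ht.le, NNReal.coe_mul, mul_assoc]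
      exact mul_le_mul_of_nonneg_left (hu.dist_le_mul x y) ht.le
    obtain ⟨hinj, himg⟩ := image_closedBall_add_of_lipschitz (R := R) hK1 hut (fun x hx => by
      rw [hu_def, indicator_of_notMem (by simpa using hx), smul_zero])
    have hder : ∀ x ∈ B, HasFDerivWithinAt (fun x => x + t • u x) (1 + t • A x) B x := by
      intro x hx
      have h1 : HasFDerivAt (fun x => x + t • (f x - x)) (1 + t • A x) x :=
        (hasFDerivAt_id x).add (((hfd x).sub (hasFDerivAt_id x)).const_smul t)
      refine h1.hasFDerivWithinAt.congr (fun y hy => ?_) ?_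
      · simp [hu_def, indicator_of_mem (show y ∈ Metric.closedBall (0 : E) R from hy)]
      · simp [hu_def, indicator_of_mem (show x ∈ Metric.closedBall (0 : E) R from hx)]
    have h2 := integral_image_eq_integral_abs_det_fderiv_smul μ
      (Metric.isClosed_closedBall (x := (0 : E)) (ε := R)).measurableSet hder hinj.injOn
      (fun _ => (1 : ℝ))
    rw [himg] at h2
    simp only [smul_eq_mul, mul_one, integral_const, MeasurableSet.univ, measureReal_restrict_apply,
      univ_inter] at h2
    rw [h2]
    refine setIntegral_congr_fun Metric.isClosed_closedBall.measurableSet fun x hx => ?_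
    refine (abs_of_pos (det_one_add_pos ?_)).symm
    rw [norm_smul, Real.norm_of_nonneg ht.le]
    have := (hK₂ x hx).trans (le_abs_self K₂)
    have h3 : t * ‖A x‖ ≤ t * |K₂| := by gcongr
    nlinarith [K₁.coe_nonneg]
  -- interpolation at `finrank + 1` small parameters
  set N := Module.finrank ℝ E
  let τ : ℝ := (K₁ + |K₂| + 2)⁻¹
  have hden : (0 : ℝ) < K₁ + |K₂| + 2 := by positivity
  have hτ : 0 < τ := inv_pos.2 hden
  have hτ1 : τ * (K₁ + |K₂| + 1) < 1 := by
    have : τ * (K₁ + |K₂| + 2) = 1 := inv_mul_cancel₀ hden.ne'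
    nlinarith
  let node : ℕ → ℝ := fun j => τ * ((j : ℝ) + 1)⁻¹
  have hnode : Set.InjOn node (Finset.range (N + 1) : Finset ℕ) := by
    intro i _ j _ hij
    have := inv_injective (mul_left_cancel₀ hτ.ne' hij)
    exact_mod_cast add_right_cancel this
  have hnode_pos : ∀ j, 0 < node j := fun j => by positivity
  have hnode_lt : ∀ j, node j * (K₁ + |K₂| + 1) < 1 := by
    intro j
    refine lt_of_le_of_lt ?_ hτ1
    have : node j ≤ τ := mul_le_of_le_one_right hτ.le (inv_le_one_of_one_le₀ (by simp))
    gcongr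
  let ℓ : ℕ → ℝ := fun j => (Lagrange.basis (Finset.range (N + 1)) node j).eval 1
  have hℓ : ∀ p : Polynomial ℝ, p.natDegree ≤ N →
      p.eval 1 = ∑ j ∈ Finset.range (N + 1), p.eval (node j) * ℓ j := by
    intro p hp
    have h1 := Lagrange.eq_interpolate_of_eval_eq (f := p) (s := Finset.range (N + 1)) (v := node)
      (fun j => p.eval (node j)) hnode (by
        rw [Finset.card_range]
        exact lt_of_le_of_lt Polynomial.degree_le_natDegree
          (by exact_mod_cast Nat.lt_succ_of_le hp)) (fun _ _ => rfl)
    conv_lhs => rw [h1]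
    simp [Lagrange.interpolate_apply, Polynomial.eval_finsetSum, ℓ]
  have hsum : ∑ j ∈ Finset.range (N + 1), ℓ j = 1 := by
    simpa using (hℓ 1 (by simp)).symm
  have hint : ∀ t : ℝ, IntegrableOn (fun x => (1 + t • A x : E →L[ℝ] E).det) B μ := fun t =>
    (ContinuousLinearMap.continuous_det.comp
      (continuous_const.add (hA.const_smul t))).continuousOn.integrableOn_compact hBc
  have h1 : ∫ x in B, (1 + (1 : ℝ) • A x : E →L[ℝ] E).det ∂μ = μ.real B := by
    have hpt : ∀ x, (1 + (1 : ℝ) • A x : E →L[ℝ] E).det =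
        ∑ j ∈ Finset.range (N + 1), (1 + node j • A x : E →L[ℝ] E).det * ℓ j := by
      intro x
      obtain ⟨p, hp, hpe⟩ := exists_polynomial_det_one_add_smul (A x)
      simp only [← hpe]
      exact hℓ p hp
    simp only [hpt]
    rw [integral_finsetSum _ fun j _ => (hint (node j)).mul_const _]
    simp only [integral_mul_const, hsmall _ (hnode_pos _) (hnode_lt _)]
    rw [← Finset.mul_sum, hsum, mul_one]
  have h0 : ∫ x in B, (1 + (1 : ℝ) • A x : E →L[ℝ] E).det ∂μ = 0 := by
    simp [A, hdet]
  have hpos : 0 < μ.real B :=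
    ENNReal.toReal_pos (Metric.measure_closedBall_pos μ _ hR).ne' hBc.measure_lt_top.ne
  linarith

/-- Brouwer's theorem: a continuous map that is the identity outside the unit ball has a zero. -/
lemma exists_zero_of_continuous_of_eq_id {H : E → E} (hH : Continuous H)
    (hid : ∀ x, 1 ≤ ‖x‖ → H x = x) : ∃ x, H x = 0 := by
  by_contra! hne
  have hU : {x : E | 1 < ‖x‖} ∈ 𝓝ˢ {x : E | 2 ≤ ‖x‖} :=
    (isOpen_lt continuous_const continuous_norm).mem_nhdsSet.2
      fun x (hx : 2 ≤ ‖x‖) => lt_of_lt_of_le one_lt_two hx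
  obtain ⟨G, hG, hGd, hGeq, -⟩ := hH.exists_contDiff_approx_and_eqOn 1 hH.norm
    (fun x => norm_pos_iff.2 (hne x)) (isClosed_le continuous_const continuous_norm) hU
    (contDiffOn_id.congr fun x (hx : 1 < ‖x‖) => hid x hx.le)
  obtain ⟨x, hx⟩ := exists_zero_of_contDiff_of_eq_id two_pos hG
    (fun x hx => (hGeq hx).trans (hid x (one_le_two.trans hx)))
  have := hGd x
  rw [hx, dist_zero_left] at this
  exact lt_irrefl _ this

/-- A sphere does not embed in a proper subset of itself. If the image misses `v`, stereographic
projection embeds the sphere in the smaller space `v^⊥`. A smooth approximation of the inverse of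
this embedding has a range with dense complement, so the identity of the sphere extends, up to a
small error, to a map of the ball that avoids a point close to `0`. -/
lemma eq_sphere_of_homeomorph {K : Set E} (hK : K ⊆ Metric.sphere (0 : E) 1)
    (e : Metric.sphere (0 : E) 1 ≃ₜ K) : K = Metric.sphere (0 : E) 1 := by
  refine Subset.antisymm hK fun v hv => ?_
  by_contra hvK
  have hv1 : ‖v‖ = 1 := by simpa using hv
  let F := (ℝ ∙ v)ᗮ
  have hF : Module.finrank ℝ F < Module.finrank ℝ E :=
    Submodule.finrank_lt fun h => by
      have : v ∈ F := h ▸ Submodule.mem_top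
      rw [Submodule.mem_orthogonal_singleton_iff_inner_right, real_inner_self_eq_norm_sq,
        hv1] at this
      norm_num at this
  let σ := stereographic hv1
  let j : Metric.sphere (0 : E) 1 → Metric.sphere (0 : E) 1 := fun x => ⟨e x, hK (e x).2⟩
  have hj : Continuous j := by fun_prop
  have hjs : ∀ x, j x ∈ σ.source := by
    intro x
    rw [stereographic_source]
    intro h
    apply hvK
    have := congrArg Subtype.val h
    simp only [j] at this
    exact this ▸ (e x).2
  let φ : Metric.sphere (0 : E) 1 → F := fun x => σ (j x)
  have hφ : Continuous φ := σ.continuousOn.comp_continuous hj hjs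
  have hφi : Function.Injective φ := by
    intro x y hxy
    have := σ.injOn (hjs x) (hjs y) hxy
    have h2 : (e x : E) = e y := congrArg (fun z : Metric.sphere (0 : E) 1 => (z : E)) this
    exact e.injective (Subtype.ext h2)
  have hφe : IsClosedEmbedding φ := hφ.isClosedEmbedding hφi
  have : TietzeExtension E := .of_tvs ℝ
  have : TietzeExtension F := .of_tvs ℝ
  obtain ⟨Ψ, hΨ⟩ := ContinuousMap.exists_extension hφe ⟨Subtype.val, continuous_subtype_val⟩
  obtain ⟨Θ, hΘ, hΘd, -⟩ := Ψ.continuous.exists_contDiff_approx 1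
    (ε := fun _ => (1 / 4 : ℝ)) continuous_const (fun _ => by norm_num)
  obtain ⟨c, hcr, hc⟩ := (hΘ.dense_compl_range_of_finrank_lt_finrank hF).exists_mem_open
    (Metric.isOpen_ball (x := (0 : E)) (ε := 1 / 4)) ⟨0, Metric.mem_ball_self (by norm_num)⟩
  have hc' : ‖c‖ < 1 / 4 := mem_ball_zero_iff.1 hc
  let S : Set E := {x | 1 / 2 ≤ ‖x‖}
  have hS : IsClosed S := isClosed_le continuous_const continuous_norm
  have hS0 : ∀ x : S, ‖(x : E)‖ ≠ 0 := fun x => by have : 1 / 2 ≤ ‖(x : E)‖ := x.2; linarith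
  let ν : S → Metric.sphere (0 : E) 1 := fun x => ⟨‖(x : E)‖⁻¹ • (x : E), by
    simp [norm_smul, inv_mul_cancel₀ (hS0 x)]⟩
  have hν : Continuous ν := Continuous.subtype_mk
    ((continuous_subtype_val.norm.inv₀ hS0).smul continuous_subtype_val) _
  obtain ⟨χ, hχ⟩ := ContinuousMap.exists_restrict_eq hS (⟨φ ∘ ν, hφ.comp hν⟩ : C(S, F))
  -- a cutoff that is `1` for `|x| ≤ 1/2` and `0` for `|x| ≥ 1`
  let b : E → ℝ := fun x => max 0 (min 1 (2 - 2 * ‖x‖))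
  have hb0 : ∀ x, 0 ≤ b x := fun x => le_max_left _ _
  have hb1 : ∀ x, b x ≤ 1 := fun x => max_le zero_le_one (min_le_left _ _)
  let H : E → E := fun x => b x • (Θ (χ x) - c) + (1 - b x) • x
  have hHc : Continuous H := by
    have := hΘ.continuous
    fun_prop
  obtain ⟨x, hx⟩ := exists_zero_of_continuous_of_eq_id hHc (fun x hx => by
    have : b x = 0 := max_eq_left ((min_le_right _ _).trans (by linarith))
    simp [H, this])
  rcases le_total (1 / 2) ‖x‖ with hx2 | hx2
  -- for `|x| ≥ 1/2` the vector `Θ (χ x) - c` is close to `x / |x|`, so `H x` is not orthogonal to `x`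
  · have hx0 : 0 < ‖x‖ := by linarith
    have h1 : χ x = φ (ν ⟨x, hx2⟩) := congrArg (fun g => g ⟨x, hx2⟩) hχ
    have h2 : Ψ (χ x) = ‖x‖⁻¹ • x := by
      rw [h1]; exact congrArg (fun g => g (ν ⟨x, hx2⟩)) hΨ
    have h3 : ‖Θ (χ x) - c - ‖x‖⁻¹ • x‖ ≤ 1 / 2 := by
      have := hΘd (χ x)
      rw [dist_eq_norm, h2] at this
      calc _ = ‖(Θ (χ x) - ‖x‖⁻¹ • x) - c‖ := by congr 1; abel
        _ ≤ _ := norm_sub_le _ _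
        _ ≤ _ := by linarith
    have h4 : inner ℝ (Θ (χ x) - c) x ≥ ‖x‖ / 2 := by
      have h5 : inner ℝ (Θ (χ x) - c) x =
          inner ℝ (Θ (χ x) - c - ‖x‖⁻¹ • x) x + ‖x‖ := by
        rw [inner_sub_left _ (‖x‖⁻¹ • x), real_inner_smul_left, real_inner_self_eq_norm_sq]
        field_simp
        ring
      have h6 := abs_real_inner_le_norm (Θ (χ x) - c - ‖x‖⁻¹ • x) x
      have h7 := neg_abs_le (inner ℝ (Θ (χ x) - c - ‖x‖⁻¹ • x) x)
      nlinarith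
    have h8 : inner ℝ (H x) x = b x * inner ℝ (Θ (χ x) - c) x + (1 - b x) * ‖x‖ ^ 2 := by
      simp only [H]
      rw [inner_add_left, real_inner_smul_left, real_inner_smul_left, real_inner_self_eq_norm_sq]
    rw [hx, inner_zero_left] at h8
    have h9 : 0 ≤ b x * (inner ℝ (Θ (χ x) - c) x - ‖x‖ / 2) :=
      mul_nonneg (hb0 x) (by linarith)
    have h10 : 0 ≤ (1 - b x) * (‖x‖ * (‖x‖ - 1 / 2)) :=
      mul_nonneg (by linarith [hb1 x]) (mul_nonneg hx0.le (by linarith))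
    nlinarith
  · have : b x = 1 := by
      simp only [b]
      rw [min_eq_left (by linarith), max_eq_right zero_le_one]
    simp only [H, this, one_smul, sub_self, zero_smul, add_zero] at hx
    exact hcr ⟨χ x, sub_eq_zero.1 hx⟩

end Topology

/-! ### Locally Lipschitz functions and causal curves -/

section RealAnalysis

variable {V W : Type*} [NormedAddCommGroup V] [NormedSpace ℝ V] [NormedAddCommGroup W]
  [NormedSpace ℝ W]

lemma LocallyLipschitzOn.comp_contDiffAt {I : Set ℝ} {c : ℝ → V} {F : V → W}
    (hc : LocallyLipschitzOn I c) (hF : ∀ s ∈ I, ContDiffAt ℝ 1 F (c s)) :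
    LocallyLipschitzOn I (F ∘ c) := by
  intro s hs
  obtain ⟨K, t, ht, hK⟩ := hc hs
  obtain ⟨K', t', ht', hK'⟩ := (hF s hs).exists_lipschitzOnWith
  refine ⟨K' * K, t ∩ c ⁻¹' t', inter_mem ht ?_, ?_⟩
  · exact hc.continuousOn s hs ht'
  · exact hK'.comp (hK.mono inter_subset_left) fun x hx => hx.2

lemma ae_mem_interior_of_ordConnected {I : Set ℝ} (hI : I.OrdConnected) :
    ∀ᵐ s ∂(volume.restrict I), s ∈ interior I := by
  rw [ae_restrict_iff' hI.measurableSet]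
  have h := hI.convex.addHaar_frontier volume
  filter_upwards [measure_eq_zero_iff_ae_notMem.1 h] with s hs hsI
  by_contra hn
  exact hs ⟨subset_closure hsI, hn⟩

lemma ae_deriv_le_zero_antitoneOn {I : Set ℝ} (hI : I.OrdConnected) {φ : ℝ → ℝ}
    (hφ : LocallyLipschitzOn I φ) (hd : ∀ᵐ s ∂(volume.restrict I), deriv φ s ≤ 0) :
    AntitoneOn φ I := by
  intro a ha b hb hab
  have hsub : Icc a b ⊆ I := hI.out ha hb
  obtain ⟨K, hK⟩ := (hφ.mono hsub).exists_lipschitzOnWith_of_compact isCompact_Icc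
  rw [← uIcc_of_le hab] at hK
  have h := hK.absolutelyContinuousOnInterval.integral_deriv_eq_sub
  have h2 : ∫ s in a..b, deriv φ s ≤ 0 := by
    rw [intervalIntegral.integral_of_le hab]
    exact integral_nonpos_of_ae (ae_restrict_of_ae_restrict_of_subset
      (Ioc_subset_Icc_self.trans hsub) hd)
  linarith

/-- The integral of the speed of descent of a locally Lipschitz function is its total descent. -/
lemma lintegral_neg_deriv_le {I : Set ℝ} (hI : I.OrdConnected) {φ : ℝ → ℝ}
    (hφ : LocallyLipschitzOn I φ) (hd : ∀ᵐ s ∂(volume.restrict I), deriv φ s ≤ 0) {a b : ℝ}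
    (ha : a ∈ I) (hb : b ∈ I) (hab : a ≤ b) :
    ∫⁻ s in Icc a b, ENNReal.ofReal (-deriv φ s) ≤ ENNReal.ofReal (φ a - φ b) := by
  have hsub : Icc a b ⊆ I := hI.out ha hb
  obtain ⟨K, hK⟩ := (hφ.mono hsub).exists_lipschitzOnWith_of_compact isCompact_Icc
  rw [← uIcc_of_le hab] at hK
  have hac := hK.absolutelyContinuousOnInterval
  have h := hac.integral_deriv_eq_sub
  have hint := (intervalIntegrable_iff_integrableOn_Ioc_of_le hab).1 hac.intervalIntegrable_deriv
  rw [← restrict_Ioc_eq_restrict_Icc]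
  rw [← ofReal_integral_eq_lintegral_ofReal (f := fun s => -deriv φ s) hint.neg, integral_neg,
    ← intervalIntegral.integral_of_le hab, h, neg_sub]
  filter_upwards [ae_restrict_of_ae_restrict_of_subset (Ioc_subset_Icc_self.trans hsub) hd]
    with s hs
  simpa using hs

/-- An integral over an interval with first point `a` is the supremum of the integrals over the
compact subintervals that start at `a`. -/
lemma setLIntegral_le_of_forall_Icc {I : Set ℝ} {a : ℝ} (hI : I.OrdConnected) (ha : IsLeast I a)
    {f : ℝ → ℝ≥0∞} {B : ℝ≥0∞} (h : ∀ b ∈ I, ∫⁻ s in Icc a b, f s ≤ B) :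
    ∫⁻ s in I, f s ≤ B := by
  by_cases hb : ∃ b, IsGreatest I b
  · obtain ⟨b, hb⟩ := hb
    have hIb : I ⊆ Icc a b := fun s hs => ⟨ha.2 hs, hb.2 hs⟩
    exact (lintegral_mono_set hIb).trans (h b hb.1)
  · push Not at hb
    have hsub : I ⊆ ⋃ q : {q : ℚ // (q : ℝ) ∈ I}, Icc a (q : ℝ) := by
      intro s hs
      have : ∃ t ∈ I, s < t := by
        by_contra! hn
        exact hb s ⟨hs, hn⟩
      obtain ⟨t, ht, hst⟩ := this
      obtain ⟨q, hq1, hq2⟩ := exists_rat_btwn hst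
      exact mem_iUnion.2 ⟨⟨q, hI.out hs ht ⟨hq1.le, hq2.le⟩⟩, ha.2 hs, hq1.le⟩
    refine (lintegral_mono_set hsub).trans ?_
    rw [setLIntegral_iUnion_of_directed]
    · exact iSup_le fun q => h _ q.2
    · intro p q
      rcases le_total (p : ℝ) (q : ℝ) with hpq | hpq
      · exact ⟨q, Icc_subset_Icc_right hpq, subset_rfl⟩
      · exact ⟨p, subset_rfl, Icc_subset_Icc_right hpq⟩

end RealAnalysis

namespace EmbeddedSpacetime

variable {V : Type*}

/-- A nonzero causal vector that is past-oriented for `σ = 1` and future-oriented for `σ = -1`. -/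
def SignedCausal (M : EmbeddedSpacetime V) (σ : ℝ) (x v : V) : Prop :=
  M.metric x v ≤ 0 ∧ σ * M.timeForm x v < 0

lemma signedCausal_one (M : EmbeddedSpacetime V) : M.SignedCausal 1 = M.PastCausal := by
  funext x v
  simp [SignedCausal, PastCausal]

lemma signedCausal_neg_one (M : EmbeddedSpacetime V) : M.SignedCausal (-1) = M.FutureCausal := by
  funext x v
  simp [SignedCausal, FutureCausal]

variable [NormedAddCommGroup V] [NormedSpace ℝ V]

/-- The derivative of a causal curve exists almost everywhere, because the value `0` given to it
where it does not exist is not a causal vector. -/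
lemma IsCurve.ae_hasDerivAt {M : EmbeddedSpacetime V} {C : V → V → Prop} {I : Set ℝ} {c : ℝ → V}
    (hc : M.IsCurve C I c) (hC : ∀ x, ¬ C x 0) :
    ∀ᵐ s ∂(volume.restrict I), s ∈ interior I ∧ HasDerivAt c (derivWithin c I s) s ∧
      C (c s) (derivWithin c I s) := by
  filter_upwards [hc.velocity, ae_mem_interior_of_ordConnected hc.ordConnected] with s hs hsI
  refine ⟨hsI, ?_, hs⟩
  have hd : DifferentiableWithinAt ℝ c I s := by
    by_contra hn
    rw [derivWithin_zero_of_not_differentiableWithinAt hn] at hs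
    exact hC _ hs
  exact hd.hasDerivWithinAt.hasDerivAt (mem_interior_iff_mem_nhds.1 hsI)

end EmbeddedSpacetime

/-! ### The distance to a boundary point along causal curves of the cover -/

namespace AdS

open EmbeddedSpacetime

variable {n : ℕ}

/-- The spherical distance between the projections to the closed hemisphere of `x` and of a
boundary point `p`. -/
def sphereDist (p x : CoverAmbient n) : ℝ := Real.arccos (inner ℝ x.2.2 p.2.2)

/-- An approximation of `sphereDist` that for `0 ≤ r < 1` is smooth also at the boundary point and at
its antipode, where `arccos` is not differentiable. -/
def sphereDistApprox (r : ℝ) (p x : CoverAmbient n) : ℝ := Real.arccos (r * inner ℝ x.2.2 p.2.2)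

lemma tendsto_sphereDistApprox (p x : CoverAmbient n) :
    Tendsto (fun r => sphereDistApprox r p x) (𝓝[<] 1) (𝓝 (sphereDist p x)) := by
  have : Continuous fun r : ℝ => sphereDistApprox r p x :=
    Real.continuous_arccos.comp (by fun_prop)
  have h := (this.tendsto 1).mono_left (nhdsWithin_le_nhds (s := Iio 1))
  simpa [sphereDistApprox, sphereDist] using h

lemma continuous_sphereDist (p : CoverAmbient n) : Continuous (sphereDist p) :=
  Real.continuous_arccos.comp (by fun_prop)

lemma norm_le_one_of_mem_coverClosure {x : CoverAmbient n} (hx : x ∈ (coverClosure n).carrier) :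
    ‖x.2.2‖ ≤ 1 := by
  have h := hx.2
  nlinarith [sq_nonneg x.2.1, norm_nonneg x.2.2]

lemma abs_mul_inner_lt_one {r : ℝ} (hr : r ∈ Ico (0 : ℝ) 1) {p x : CoverAmbient n}
    (hp : ‖p.2.2‖ = 1) (hx : x ∈ (coverClosure n).carrier) :
    |r * inner ℝ x.2.2 p.2.2| < 1 := by
  have h1 := abs_real_inner_le_norm x.2.2 p.2.2
  have h2 := norm_le_one_of_mem_coverClosure hx
  rw [hp, mul_one] at h1
  rw [abs_mul, abs_of_nonneg hr.1]
  have := hr.2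
  nlinarith [hr.1, abs_nonneg (inner ℝ x.2.2 p.2.2)]

lemma contDiffAt_sphereDistApprox {r : ℝ} (hr : r ∈ Ico (0 : ℝ) 1) {p x : CoverAmbient n}
    (hp : ‖p.2.2‖ = 1) (hx : x ∈ (coverClosure n).carrier) :
    ContDiffAt ℝ 1 (sphereDistApprox r p) x := by
  obtain ⟨h1, h2⟩ := abs_lt.1 (abs_mul_inner_lt_one hr hp hx)
  refine ContDiffAt.comp x (Real.contDiffAt_arccos h1.ne' h2.ne) ?_
  exact contDiffAt_const.mul (ContDiffAt.inner ℝ (contDiffAt_snd.comp x contDiffAt_snd)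
    contDiffAt_const)

/-- Along a curve in `ℝ` times the hemisphere the approximate distance to a boundary point varies
at most as fast as the curve moves in the hemisphere: if `w` is the inner product with the
boundary point, then `w'² ≤ |X'|² (1 - w²)`. -/
lemma exists_hasDerivAt_sphereDistApprox {r : ℝ} (hr : r ∈ Ico (0 : ℝ) 1) {p : CoverAmbient n}
    (hp : ‖p.2.2‖ = 1) {γ : ℝ → CoverAmbient n} {v : CoverAmbient n} {s : ℝ}
    (hγ : ∀ᶠ u in 𝓝 s, γ u ∈ (coverClosure n).carrier) (hv : HasDerivAt γ v s) :
    ∃ d, HasDerivAt (sphereDistApprox r p ∘ γ) d s ∧ d ^ 2 ≤ v.2.1 ^ 2 + ‖v.2.2‖ ^ 2 := by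
  have hx := hγ.self_of_nhds
  set x := γ s with hxdef
  set w := inner ℝ x.2.2 p.2.2 with hw
  have hv2 : HasDerivAt (fun u => (γ u).2.1) v.2.1 s := hv.snd.fst
  have hv3 : HasDerivAt (fun u => (γ u).2.2) v.2.2 s := hv.snd.snd
  have htan : x.2.1 * v.2.1 + inner ℝ x.2.2 v.2.2 = 0 := by
    have h1 : HasDerivAt (fun u => (γ u).2.1 ^ 2 + ‖(γ u).2.2‖ ^ 2) 0 s :=
      (hasDerivAt_const s (1 : ℝ)).congr_of_eventuallyEq (hγ.mono fun u hu => hu.2)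
    have h2 := (hv2.pow 2).add hv3.norm_sq
    have h3 := h2.unique h1
    simp only [Nat.cast_ofNat] at h3
    norm_num at h3
    linarith
  have hcs : (inner ℝ v.2.2 p.2.2) ^ 2 ≤ (v.2.1 ^ 2 + ‖v.2.2‖ ^ 2) * (1 - w ^ 2) := by
    have h1 : inner ℝ v.2.2 p.2.2 =
        inner ℝ v.2.2 (p.2.2 - w • x.2.2) + v.2.1 * (-(w * x.2.1)) := by
      rw [inner_sub_right, real_inner_smul_right, real_inner_comm x.2.2 v.2.2]
      linear_combination w * htan
    have h2 : ‖p.2.2 - w • x.2.2‖ ^ 2 + (w * x.2.1) ^ 2 = 1 - w ^ 2 := by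
      rw [norm_sub_sq_real, real_inner_smul_right, real_inner_comm, ← hw, norm_smul, hp,
        mul_pow, Real.norm_eq_abs, sq_abs]
      linear_combination w ^ 2 * hx.2
    have h3 := abs_real_inner_le_norm v.2.2 (p.2.2 - w • x.2.2)
    have h4 : (inner ℝ v.2.2 (p.2.2 - w • x.2.2)) ^ 2 ≤
        ‖v.2.2‖ ^ 2 * ‖p.2.2 - w • x.2.2‖ ^ 2 := by
      rw [← mul_pow, ← sq_abs]
      gcongr
    set A := inner ℝ v.2.2 (p.2.2 - w • x.2.2)
    set a := ‖v.2.2‖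
    set b := ‖p.2.2 - w • x.2.2‖
    have h5 : |A| ≤ a * b := h3
    have h6 : A * (v.2.1 * (-(w * x.2.1))) ≤ (a * b) * |v.2.1 * (w * x.2.1)| := by
      calc _ ≤ |A * (v.2.1 * (-(w * x.2.1)))| := le_abs_self _
        _ = |A| * |v.2.1 * (w * x.2.1)| := by rw [abs_mul]; congr 1; rw [mul_neg, abs_neg]
        _ ≤ _ := by gcongr
    rw [abs_mul] at h6
    rw [h1, ← h2]
    have h7 : 2 * ((a * b) * (|v.2.1| * |w * x.2.1|)) ≤
        (a * |w * x.2.1|) ^ 2 + (|v.2.1| * b) ^ 2 := by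
      nlinarith [sq_nonneg (a * |w * x.2.1| - |v.2.1| * b)]
    rw [mul_pow, mul_pow, sq_abs, sq_abs] at h7
    nlinarith
  obtain ⟨hl, hu⟩ := abs_lt.1 (abs_mul_inner_lt_one hr hp hx)
  have hder : HasDerivAt (fun u => r * inner ℝ (γ u).2.2 p.2.2) (r * inner ℝ v.2.2 p.2.2) s := by
    have := (hv3.inner ℝ (hasDerivAt_const s p.2.2)).const_mul r
    simpa using this
  refine ⟨_, (Real.hasDerivAt_arccos hl.ne' hu.ne).comp s hder, ?_⟩
  have hpos : 0 < 1 - (r * w) ^ 2 := by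
    have := abs_mul_inner_lt_one hr hp hx
    rw [← sq_lt_one_iff_abs_lt_one] at this
    linarith
  rw [mul_pow, neg_sq, div_pow, one_pow, Real.sq_sqrt hpos.le, div_mul_eq_mul_div, one_mul,
    div_le_iff₀ hpos, mul_pow]
  have hr2 : r ^ 2 ≤ 1 := by nlinarith [hr.1, hr.2]
  calc r ^ 2 * (inner ℝ v.2.2 p.2.2) ^ 2
      ≤ r ^ 2 * ((v.2.1 ^ 2 + ‖v.2.2‖ ^ 2) * (1 - w ^ 2)) := by gcongr
    _ = (v.2.1 ^ 2 + ‖v.2.2‖ ^ 2) * (r ^ 2 - (r * w) ^ 2) := by ring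
    _ ≤ _ := by gcongr

variable {σ : ℝ} {I : Set ℝ} {γ : ℝ → CoverAmbient n}

lemma not_signedCausal_zero (x : CoverAmbient n) : ¬ (coverClosure n).SignedCausal σ x 0 := by
  intro h
  simpa [coverClosure] using h.2

lemma locallyLipschitzOn_signed_time_add
    (hγ : (coverClosure n).IsCurve ((coverClosure n).SignedCausal σ) I γ) (k : ℝ) {r : ℝ}
    (hr : r ∈ Ico (0 : ℝ) 1) {p : CoverAmbient n} (hp : ‖p.2.2‖ = 1) :
    LocallyLipschitzOn I (fun s => σ * (γ s).1 + k * sphereDistApprox r p (γ s)) :=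
  hγ.locallyLipschitz.comp_contDiffAt (F := fun x => σ * x.1 + k * sphereDistApprox r p x)
    fun _ hs => (contDiffAt_const.mul contDiffAt_fst).add
      (contDiffAt_const.mul (contDiffAt_sphereDistApprox hr hp (hγ.mapsTo hs)))

lemma ae_exists_hasDerivAt_sphereDistApprox (hσ : σ ^ 2 = 1)
    (hγ : (coverClosure n).IsCurve ((coverClosure n).SignedCausal σ) I γ) {r : ℝ}
    (hr : r ∈ Ico (0 : ℝ) 1) {p : CoverAmbient n} (hp : ‖p.2.2‖ = 1) :
    ∀ᵐ s ∂(volume.restrict I), ∃ S' D' : ℝ, HasDerivAt (fun s => σ * (γ s).1) S' s ∧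
      HasDerivAt (fun s => sphereDistApprox r p (γ s)) D' s ∧ S' ≤ 0 ∧ |D'| ≤ -S' ∧
      -productMetric n (γ s) (derivWithin γ I s) ≤ S' ^ 2 - D' ^ 2 := by
  filter_upwards [hγ.ae_hasDerivAt not_signedCausal_zero] with s hs
  obtain ⟨hsI, hd, hm, ht⟩ := hs
  set v := derivWithin γ I s
  obtain ⟨d, hd1, hd2⟩ := exists_hasDerivAt_sphereDistApprox hr hp
    (mem_of_superset (mem_interior_iff_mem_nhds.1 hsI) fun u hu => hγ.mapsTo hu) hd
  have ht' : σ * v.1 < 0 := ht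
  have hm' : -(v.1 ^ 2) + (v.2.1 ^ 2 + ‖v.2.2‖ ^ 2) ≤ 0 := hm
  have hS2 : (σ * v.1) ^ 2 = v.1 ^ 2 := by rw [mul_pow, hσ, one_mul]
  refine ⟨σ * v.1, d, HasDerivAt.const_mul σ hd.fst, hd1, ht'.le, ?_, ?_⟩
  · refine abs_le_of_sq_le_sq ?_ (by linarith)
    rw [neg_sq, hS2]
    linarith
  · rw [hS2, productMetric]
    linarith

/-- A causal curve moves in the hemisphere at most as fast as time passes. -/
lemma antitoneOn_signed_time_add_sphereDist (hσ : σ ^ 2 = 1)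
    (hγ : (coverClosure n).IsCurve ((coverClosure n).SignedCausal σ) I γ) {k : ℝ} (hk : |k| ≤ 1)
    {p : CoverAmbient n} (hp : ‖p.2.2‖ = 1) :
    AntitoneOn (fun s => σ * (γ s).1 + k * sphereDist p (γ s)) I := by
  intro a ha b hb hab
  have hlim : ∀ s, Tendsto (fun r => σ * (γ s).1 + k * sphereDistApprox r p (γ s)) (𝓝[<] 1)
      (𝓝 (σ * (γ s).1 + k * sphereDist p (γ s))) := fun s =>
    ((tendsto_sphereDistApprox p (γ s)).const_mul k).const_add _
  refine le_of_tendsto_of_tendsto (hlim b) (hlim a) ?_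
  filter_upwards [Ico_mem_nhdsLT (zero_lt_one (α := ℝ))] with r hr
  refine ae_deriv_le_zero_antitoneOn hγ.ordConnected
    (locallyLipschitzOn_signed_time_add hγ k hr hp) ?_ ha hb hab
  filter_upwards [ae_exists_hasDerivAt_sphereDistApprox hσ hγ hr hp] with s hs
  obtain ⟨S', D', hS, hD, -, hSD, -⟩ := hs
  have hd : HasDerivAt (fun s => σ * (γ s).1 + k * sphereDistApprox r p (γ s)) (S' + k * D') s :=
    hS.add (hD.const_mul k)
  rw [hd.deriv]
  have h1 : |k * D'| ≤ |D'| := by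
    rw [abs_mul]
    exact mul_le_of_le_one_left (abs_nonneg _) hk
  linarith [le_abs_self (k * D')]

/-- The inequality of arithmetic and geometric means in the form that bounds the speed of a causal
curve. -/
lemma sqrt_sq_sub_sq_le {S D ε : ℝ} (hε : 0 < ε) (h : |D| ≤ -S) :
    √(S ^ 2 - D ^ 2) ≤ 2⁻¹ * (ε⁻¹ * (-(S + D)) + 2 * ε * (-S)) := by
  obtain ⟨h1, h2⟩ := abs_le.1 h
  have ha : 0 ≤ -(S + D) := by linarith
  have hb : 0 ≤ -S + D := by linarith
  have h3 : √(S ^ 2 - D ^ 2) ≤ 2⁻¹ * (ε⁻¹ * (-(S + D)) + ε * (-S + D)) := by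
    rw [Real.sqrt_le_left (by positivity)]
    have h4 : ε⁻¹ * ε = 1 := inv_mul_cancel₀ hε.ne'
    have h5 : S ^ 2 - D ^ 2 = (ε⁻¹ * (-(S + D))) * (ε * (-S + D)) := by
      linear_combination (-(S ^ 2 - D ^ 2)) * h4
    rw [h5]
    nlinarith [sq_nonneg (ε⁻¹ * (-(S + D)) - ε * (-S + D))]
  refine h3.trans ?_
  have : ε * (-S + D) ≤ ε * (2 * -S) := by gcongr; linarith
  linarith

/-- The length bound. With `S` the signed time and `D` the distance to a boundary point, the length
element is at most `δ⁻¹ √(S'² - D'²) = δ⁻¹ √((S' + D') (S' - D'))`, and by the inequality of the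
means it is bounded by the total descents of `S + D` and of `S`. -/
lemma lintegral_speed_le (hσ : σ ^ 2 = 1)
    (hγ : (coverClosure n).IsCurve ((coverClosure n).SignedCausal σ) I γ) (hI : IsLeast I 0)
    {p : CoverAmbient n} (hp : ‖p.2.2‖ = 1) {δ ε A B : ℝ} (hδ : 0 < δ)
    (hh : ∀ s ∈ I, δ ≤ (γ s).2.1) (hε : 0 < ε)
    (hA : ∀ s ∈ I, (σ * (γ 0).1 + sphereDist p (γ 0)) - (σ * (γ s).1 + sphereDist p (γ s)) ≤ A)
    (hB : ∀ s ∈ I, σ * (γ 0).1 - σ * (γ s).1 ≤ B) :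
    ∫⁻ s in I, ENNReal.ofReal (√(-productMetric n (γ s) (derivWithin γ I s)) / (γ s).2.1) ≤
      ENNReal.ofReal ((2 * δ)⁻¹ * (ε⁻¹ * A + 2 * ε * B)) := by
  refine setLIntegral_le_of_forall_Icc hγ.ordConnected hI fun b hb => ?_
  let φ : ℝ → ℝ → ℝ := fun r s =>
    (2 * δ)⁻¹ * (ε⁻¹ * (σ * (γ s).1 + 1 * sphereDistApprox r p (γ s)) + 2 * ε * (σ * (γ s).1))
  have hsub : Icc 0 b ⊆ I := hγ.ordConnected.out hI.1 hb
  have hr_bound : ∀ r ∈ Ico (0 : ℝ) 1,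
      ∫⁻ s in Icc 0 b, ENNReal.ofReal (√(-productMetric n (γ s) (derivWithin γ I s)) / (γ s).2.1) ≤
        ENNReal.ofReal (φ r 0 - φ r b) := by
    intro r hr
    have hlip : LocallyLipschitzOn I (φ r) :=
      hγ.locallyLipschitz.comp_contDiffAt (F := fun x : CoverAmbient n =>
        (2 * δ)⁻¹ * (ε⁻¹ * (σ * x.1 + 1 * sphereDistApprox r p x) + 2 * ε * (σ * x.1)))
        fun s hs => by
          have := contDiffAt_sphereDistApprox hr hp (hγ.mapsTo hs)
          fun_prop
    have hder : ∀ᵐ s ∂(volume.restrict I), deriv (φ r) s ≤ 0 ∧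
        √(-productMetric n (γ s) (derivWithin γ I s)) / (γ s).2.1 ≤ -deriv (φ r) s := by
      filter_upwards [ae_exists_hasDerivAt_sphereDistApprox hσ hγ hr hp,
        ae_restrict_mem hγ.ordConnected.measurableSet] with s hs hsI
      obtain ⟨S', D', hS, hD, -, hSD, hm⟩ := hs
      have hd : deriv (φ r) s = -(δ⁻¹ * (2⁻¹ * (ε⁻¹ * (-(S' + D')) + 2 * ε * (-S')))) := by
        have hφ : HasDerivAt (φ r)
            ((2 * δ)⁻¹ * (ε⁻¹ * (S' + 1 * D') + 2 * ε * S')) s :=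
          (((hS.add (hD.const_mul 1)).const_mul ε⁻¹).add (hS.const_mul (2 * ε))).const_mul _
        rw [hφ.deriv, mul_inv]
        ring
      have hδh := hh s hsI
      have h1 : √(-productMetric n (γ s) (derivWithin γ I s)) / (γ s).2.1 ≤ -deriv (φ r) s := by
        rw [hd, neg_neg, div_eq_inv_mul]
        gcongr
        exact (Real.sqrt_le_sqrt hm).trans (sqrt_sq_sub_sq_le hε hSD)
      refine ⟨?_, h1⟩
      have : 0 ≤ √(-productMetric n (γ s) (derivWithin γ I s)) / (γ s).2.1 :=
        div_nonneg (Real.sqrt_nonneg _) (hδ.le.trans hδh)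
      linarith
    refine le_trans ?_ (lintegral_neg_deriv_le hγ.ordConnected hlip (hder.mono fun s hs => hs.1)
      hI.1 hb (hI.2 hb))
    refine lintegral_mono_ae ?_
    filter_upwards [ae_restrict_of_ae_restrict_of_subset hsub hder] with s hs
    exact ENNReal.ofReal_le_ofReal hs.2
  have hlim : Tendsto (fun r => ENNReal.ofReal (φ r 0 - φ r b)) (𝓝[<] 1)
      (𝓝 (ENNReal.ofReal ((2 * δ)⁻¹ * (ε⁻¹ * ((σ * (γ 0).1 + 1 * sphereDist p (γ 0)) -
        (σ * (γ b).1 + 1 * sphereDist p (γ b))) +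
        2 * ε * (σ * (γ 0).1 - σ * (γ b).1))))) := by
    refine ENNReal.tendsto_ofReal ?_
    have h : ∀ s, Tendsto (fun r => φ r s) (𝓝[<] 1) (𝓝 ((2 * δ)⁻¹ * (ε⁻¹ *
        (σ * (γ s).1 + 1 * sphereDist p (γ s)) + 2 * ε * (σ * (γ s).1)))) := fun s =>
      ((((tendsto_sphereDistApprox p (γ s)).const_mul 1).const_add _ |>.const_mul _).add_const
        _).const_mul _
    convert (h 0).sub (h b) using 2
    ring
  refine (ge_of_tendsto hlim ?_).trans (ENNReal.ofReal_le_ofReal ?_)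
  · filter_upwards [Ico_mem_nhdsLT (zero_lt_one (α := ℝ))] with r hr using hr_bound r hr
  · have h1 := hA b hb
    have h2 := hB b hb
    rw [one_mul, one_mul]
    gcongr

/-! ### The invisible domain and the achronal sphere -/

/-- Two points on a meridian from a boundary point are joined by a future causal curve if their
time difference is at least their distance. -/
lemma joined_meridian {y u : Euc n} {k t₀ t₁ θ₀ θ₁ : ℝ} (hk : 0 ≤ k) (hy : ‖y‖ = 1)
    (hu : k ^ 2 + ‖u‖ ^ 2 = 1) (hyu : inner ℝ y u = 0) (h₀ : θ₀ ∈ Icc 0 Real.pi)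
    (h₁ : θ₁ ∈ Icc 0 Real.pi) (ht : t₀ < t₁) (hθ : |θ₁ - θ₀| ≤ t₁ - t₀) :
    (coverClosure n).Joined (coverClosure n).FutureCausal
      (t₀, Real.sin θ₀ * k, Real.cos θ₀ • y + Real.sin θ₀ • u)
      (t₁, Real.sin θ₁ * k, Real.cos θ₁ • y + Real.sin θ₁ • u) := by
  let θ : ℝ → ℝ := fun s => θ₀ + s * (θ₁ - θ₀)
  let c : ℝ → CoverAmbient n := fun s =>
    (t₀ + s * (t₁ - t₀), Real.sin (θ s) * k, Real.cos (θ s) • y + Real.sin (θ s) • u)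
  have hθd : ∀ s, HasDerivAt θ (θ₁ - θ₀) s := fun s => by
    have h := ((hasDerivAt_id s).mul_const (θ₁ - θ₀)).const_add θ₀
    rw [one_mul] at h
    exact h
  have hc : ∀ s, HasDerivAt c (t₁ - t₀, Real.cos (θ s) * (θ₁ - θ₀) * k,
      (-Real.sin (θ s) * (θ₁ - θ₀)) • y + (Real.cos (θ s) * (θ₁ - θ₀)) • u) s := by
    intro s
    have h1 : HasDerivAt (fun s => t₀ + s * (t₁ - t₀)) (t₁ - t₀) s := by
      simpa using ((hasDerivAt_id s).mul_const (t₁ - t₀)).const_add t₀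
    have hs := (hθd s).sin
    have hcs := (hθd s).cos
    exact h1.prodMk ((hs.mul_const k).prodMk ((hcs.smul_const y).add (hs.smul_const u)))
  have hcd : ContDiff ℝ 1 c := by
    have : ContDiff ℝ 1 θ := by fun_prop
    refine ContDiff.prodMk (by fun_prop) (ContDiff.prodMk ?_ ?_)
    · exact (Real.contDiff_sin.comp this).mul contDiff_const
    · exact ((Real.contDiff_cos.comp this).smul contDiff_const).add
        ((Real.contDiff_sin.comp this).smul contDiff_const)
  have hnorm : ∀ a b : ℝ, ‖a • y + b • u‖ ^ 2 = a ^ 2 + b ^ 2 * ‖u‖ ^ 2 := by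
    intro a b
    rw [norm_add_sq_real, real_inner_smul_left, real_inner_smul_right, hyu, norm_smul, norm_smul,
      hy, mul_pow, mul_pow, Real.norm_eq_abs, Real.norm_eq_abs, sq_abs, sq_abs]
    ring
  refine ⟨0, 1, c, zero_lt_one, ⟨ordConnected_Icc, ?_, ?_, ?_⟩, by simp [c, θ], by simp [c, θ]⟩
  · intro s hs
    have hθs : θ s ∈ Icc 0 Real.pi := by
      have := (convex_Icc (0 : ℝ) Real.pi) h₀ h₁ (sub_nonneg.2 hs.2) hs.1 (sub_add_cancel 1 s)
      convert this using 1
      simp only [θ, smul_eq_mul]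
      ring
    refine ⟨mul_nonneg (Real.sin_nonneg_of_mem_Icc hθs) hk, ?_⟩
    simp only [c, hnorm]
    linear_combination Real.sin (θ s) ^ 2 * hu + Real.sin_sq_add_cos_sq (θ s)
  · intro s _
    obtain ⟨K, t, ht, hK⟩ := hcd.locallyLipschitz s
    exact ⟨K, t, mem_nhdsWithin_of_mem_nhds ht, hK⟩
  · filter_upwards [ae_restrict_mem measurableSet_Icc] with s hs
    rw [(hc s).hasDerivWithinAt.derivWithin (uniqueDiffOn_Icc zero_lt_one s hs)]
    refine ⟨?_, sub_pos.2 ht⟩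
    have h2 : (θ₁ - θ₀) ^ 2 ≤ (t₁ - t₀) ^ 2 := by
      rw [← sq_abs (θ₁ - θ₀)]
      gcongr
    simp only [coverClosure, productMetric, hnorm]
    have h3 := Real.sin_sq_add_cos_sq (θ s)
    have h4 : (Real.cos (θ s) * (θ₁ - θ₀) * k) ^ 2 + ((-Real.sin (θ s) * (θ₁ - θ₀)) ^ 2 +
        (Real.cos (θ s) * (θ₁ - θ₀)) ^ 2 * ‖u‖ ^ 2) = (θ₁ - θ₀) ^ 2 := by
      linear_combination (θ₁ - θ₀) ^ 2 * h3 + Real.cos (θ s) ^ 2 * (θ₁ - θ₀) ^ 2 * hu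
    linarith

lemma abs_inner_lt_one_of_height_pos {x : CoverAmbient n} (hx : x ∈ (coverClosure n).carrier)
    (hh : 0 < x.2.1) {y : Euc n} (hy : ‖y‖ = 1) : |inner ℝ x.2.2 y| < 1 := by
  have h1 := abs_real_inner_le_norm x.2.2 y
  rw [hy, mul_one] at h1
  have h2 := hx.2
  refine h1.trans_lt ?_
  nlinarith [norm_nonneg x.2.2]

lemma sphereDist_pos {x p : CoverAmbient n} (hx : x ∈ (coverClosure n).carrier)
    (hh : 0 < x.2.1) (hp : ‖p.2.2‖ = 1) : 0 < sphereDist p x :=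
  Real.arccos_pos.2 (abs_lt.1 (abs_inner_lt_one_of_height_pos hx hh hp)).2

lemma sphereDist_lt_pi {x p : CoverAmbient n} (hx : x ∈ (coverClosure n).carrier)
    (hh : 0 < x.2.1) (hp : ‖p.2.2‖ = 1) : sphereDist p x < Real.pi := by
  have h1 := (abs_lt.1 (abs_inner_lt_one_of_height_pos hx hh hp)).1
  refine lt_of_le_of_ne (Real.arccos_le_pi _) fun h => ?_
  rw [sphereDist, Real.arccos_eq_pi] at h
  linarith

/-- Every interior point lies on a meridian from a given boundary point. -/
lemma exists_meridian {x p : CoverAmbient n} (hx : x ∈ (coverClosure n).carrier)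
    (hh : 0 < x.2.1) (hp : p ∈ (coverBoundary n).carrier) :
    ∃ (k : ℝ) (u : Euc n), 0 ≤ k ∧ k ^ 2 + ‖u‖ ^ 2 = 1 ∧ inner ℝ p.2.2 u = 0 ∧
      x = (x.1, Real.sin (sphereDist p x) * k,
        Real.cos (sphereDist p x) • p.2.2 + Real.sin (sphereDist p x) • u) := by
  obtain ⟨hl, hu⟩ := abs_lt.1 (abs_inner_lt_one_of_height_pos hx hh hp.2)
  have hcos : Real.cos (sphereDist p x) = inner ℝ x.2.2 p.2.2 := Real.cos_arccos hl.le hu.le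
  have hsin : 0 < Real.sin (sphereDist p x) :=
    Real.sin_pos_of_pos_of_lt_pi (sphereDist_pos hx hh hp.2) (sphereDist_lt_pi hx hh hp.2)
  have hsc := Real.sin_sq_add_cos_sq (sphereDist p x)
  set S := Real.sin (sphereDist p x)
  rw [hcos] at hsc ⊢
  set w := inner ℝ x.2.2 p.2.2 with hw
  refine ⟨S⁻¹ * x.2.1, S⁻¹ • (x.2.2 - w • p.2.2), by positivity, ?_, ?_, ?_⟩
  · rw [norm_smul, mul_pow, mul_pow, norm_sub_sq_real, real_inner_smul_right, ← hw, norm_smul, hp.2,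
      Real.norm_eq_abs, Real.norm_eq_abs, sq_abs, mul_pow, sq_abs, ← mul_add]
    have : x.2.1 ^ 2 + (‖x.2.2‖ ^ 2 - 2 * (w * w) + w ^ 2 * 1 ^ 2) = S ^ 2 := by
      linear_combination hx.2 - hsc
    rw [this, ← mul_pow, inv_mul_cancel₀ hsin.ne', one_pow]
  · rw [real_inner_smul_right, inner_sub_right, real_inner_smul_right, real_inner_self_eq_norm_sq,
      hp.2, real_inner_comm, ← hw]
    ring
  · rw [← mul_assoc, mul_inv_cancel₀ hsin.ne', one_mul, smul_smul, mul_inv_cancel₀ hsin.ne',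
      one_smul, add_sub_cancel]

lemma sphereDist_self {p : CoverAmbient n} (hp : ‖p.2.2‖ = 1) : sphereDist p p = 0 := by
  simp [sphereDist, hp]

/-- An interior point is invisible from `L` if and only if its distance to every point of `L`
exceeds the time difference. -/
lemma mem_invisibleDomain_iff {L : Set (CoverAmbient n)} (hL : L ⊆ (coverBoundary n).carrier)
    {x : CoverAmbient n} (hx : x ∈ (coverClosure n).carrier) (hh : 0 < x.2.1) :
    x ∈ invisibleDomain n L ↔ ∀ p ∈ L, |x.1 - p.1| < sphereDist p x := by
  constructor
  · intro hmem p hp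
    by_contra! hle
    have hpB := hL hp
    obtain ⟨k, u, hk, hu, hyu, hxe⟩ := exists_meridian hx hh hpB
    have hd0 := sphereDist_pos hx hh hpB.2
    have hd : sphereDist p x ∈ Icc 0 Real.pi := ⟨hd0.le, (sphereDist_lt_pi hx hh hpB.2).le⟩
    have hpe : p = (p.1, Real.sin 0 * k, Real.cos 0 • p.2.2 + Real.sin 0 • u) := by
      rw [Real.sin_zero, Real.cos_zero, zero_mul, one_smul, zero_smul, add_zero, ← hpB.1]
    have h0 : (0 : ℝ) ∈ Icc 0 Real.pi := ⟨le_rfl, Real.pi_pos.le⟩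
    rcases le_abs.1 hle with h | h
    · refine hmem.2 (Or.inr ⟨hx, p, hp, Or.inr ?_⟩)
      have hJ := joined_meridian (t₀ := p.1) (t₁ := x.1) hk hpB.2 hu hyu h0 hd (by linarith)
        (by rwa [sub_zero, abs_of_pos hd0])
      rwa [← hxe, ← hpe] at hJ
    · refine hmem.2 (Or.inl ⟨hx, p, hp, Or.inr ?_⟩)
      have hJ := joined_meridian (t₀ := x.1) (t₁ := p.1) hk hpB.2 hu hyu hd h0 (by linarith)
        (by rw [zero_sub, abs_neg, abs_of_pos hd0]; linarith)
      rwa [← hxe, ← hpe] at hJ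
  · intro hmem
    refine ⟨hx, ?_⟩
    have hne : ∀ p ∈ L, p ≠ x := by
      rintro p hp rfl
      exact hh.ne' (hL hp).1
    have hanti : ∀ p ∈ L, ∀ q₀ q₁, (coverClosure n).Joined (coverClosure n).FutureCausal q₀ q₁ →
        |sphereDist p q₁ - sphereDist p q₀| ≤ q₁.1 - q₀.1 := by
      rintro p hp _ _ ⟨a, b, c, hab, hc, rfl, rfl⟩
      rw [← signedCausal_neg_one] at hc
      have h1 := antitoneOn_signed_time_add_sphereDist (by norm_num) hc (k := 1) (by simp)
        (hL hp).2 (left_mem_Icc.2 hab.le) (right_mem_Icc.2 hab.le) hab.le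
      have h2 := antitoneOn_signed_time_add_sphereDist (by norm_num) hc (k := -1) (by simp)
        (hL hp).2 (left_mem_Icc.2 hab.le) (right_mem_Icc.2 hab.le) hab.le
      simp only at h1 h2
      rw [abs_le]
      constructor <;> linarith
    rintro (⟨-, p, hp, h | h⟩ | ⟨-, p, hp, h | h⟩)
    · exact hne p hp h.symm
    · have h1 := hanti p hp _ _ h
      rw [sphereDist_self (hL hp).2] at h1
      have h2 := hmem p hp
      linarith [neg_abs_le (x.1 - p.1), neg_abs_le (0 - sphereDist p x)]
    · exact hne p hp h
    · have h1 := hanti p hp _ _ h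
      rw [sphereDist_self (hL hp).2] at h1
      have h2 := hmem p hp
      linarith [le_abs_self (x.1 - p.1), le_abs_self (sphereDist p x - 0)]

/-- A vertical segment is timelike, so that an achronal set is a graph. -/
lemma IsAchronalSphere.injOn {L : Set (CoverAmbient n)} (hL : IsAchronalSphere n L) :
    InjOn (fun p : CoverAmbient n => p.2.2) L := by
  have key : ∀ p ∈ L, ∀ q ∈ L, p.2.2 = q.2.2 → ¬ p.1 < q.1 := by
    intro p hp q hq hpq hlt
    have hpB := hL.1.1 hp
    have hqB := hL.1.1 hq
    refine hL.1.2 p hp q hq ⟨p.1, q.1, fun s => (s, 0, p.2.2), hlt,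
      ⟨ordConnected_Icc, fun s _ => ⟨rfl, hpB.2⟩, ?_, ?_⟩, ?_, ?_⟩
    · have h : ContDiff ℝ 1 fun s : ℝ => ((s, 0, p.2.2) : CoverAmbient n) := by fun_prop
      intro s _
      obtain ⟨K, t, ht, hK⟩ := h.locallyLipschitz s
      exact ⟨K, t, mem_nhdsWithin_of_mem_nhds ht, hK⟩
    · filter_upwards [ae_restrict_mem measurableSet_Icc] with s hs
      have h : HasDerivAt (fun s : ℝ => ((s, 0, p.2.2) : CoverAmbient n)) (1, 0, 0) s :=
        (hasDerivAt_id s).prodMk (hasDerivAt_const s ((0, p.2.2) : ℝ × Euc n))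
      rw [h.hasDerivWithinAt.derivWithin (uniqueDiffOn_Icc hlt s hs)]
      simp [FutureTimelike, coverBoundary, productMetric]
    · rw [← hpB.1]
    · rw [hpq, ← hqB.1]
  intro p hp q hq hpq
  have h1 : p.1 = q.1 :=
    le_antisymm (not_lt.1 (key q hq p hp hpq.symm)) (not_lt.1 (key p hp q hq hpq))
  exact Prod.ext h1 (Prod.ext ((hL.1.1 hp).1.trans (hL.1.1 hq).1.symm) hpq)

lemma IsAchronalSphere.isCompact {L : Set (CoverAmbient n)} (hL : IsAchronalSphere n L) :
    IsCompact L := by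
  obtain ⟨e⟩ := hL.2
  have : CompactSpace L := e.symm.compactSpace
  exact isCompact_iff_compactSpace.2 this

/-- An achronal sphere meets every vertical line of the boundary: its projection to the equator is
an embedding of a sphere in a sphere of the same dimension, hence onto. -/
lemma IsAchronalSphere.exists_mem {L : Set (CoverAmbient n)} (hL : IsAchronalSphere n L)
    {y : Euc n} (hy : ‖y‖ = 1) : ∃ p ∈ L, p.2.2 = y := by
  obtain ⟨e⟩ := hL.2
  have : CompactSpace L := e.symm.compactSpace
  let E := Equiv.Set.imageOfInjOn (fun p : CoverAmbient n => p.2.2) L hL.injOn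
  have hE : Continuous E := by
    refine Continuous.subtype_mk (f := fun p : L => (p : CoverAmbient n).2.2) ?_ _
    fun_prop
  have h := eq_sphere_of_homeomorph (K := (fun p : CoverAmbient n => p.2.2) '' L) (by
    rintro _ ⟨p, hp, rfl⟩
    simpa using (hL.1.1 hp).2) (e.symm.trans hE.homeoOfEquivCompactToT2)
  have hy' : y ∈ (fun p : CoverAmbient n => p.2.2) '' L := by rw [h]; simpa using hy
  exact hy'

end AdS

/-! ### The lift of the regular domain to the universal cover -/

namespace AdS

open EmbeddedSpacetime

variable {n : ℕ}

lemma Q_eq (x : Ambient n) : Q n x = -‖x.1‖ ^ 2 + ‖x.2‖ ^ 2 := by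
  rw [Q, EuclideanSpace.norm_sq_eq, Complex.sq_norm, Complex.normSq_apply]
  simp only [Real.norm_eq_abs, sq_abs]
  ring

lemma fst_ne_zero_of_mem_quadric {x : Ambient n} (hx : x ∈ quadric n) : x.1 ≠ 0 := by
  intro h
  have h1 : Q n x = -1 := hx
  rw [Q_eq, h, norm_zero] at h1
  nlinarith [sq_nonneg ‖x.2‖]

/-- The lift of a point of `AdS_n` to the universal cover with time coordinate in
`(t₀ - π, t₀ + π]`. -/
def lift (t₀ : ℝ) (x : Ambient n) : CoverAmbient n :=
  (t₀ + Complex.arg (x.1 * Complex.exp (-(t₀ * Complex.I))), ‖x.1‖⁻¹, ‖x.1‖⁻¹ • x.2)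

/-- The inverse of the conformal map, composed with the covering projection. -/
def unlift (q : CoverAmbient n) : Ambient n :=
  ((q.2.1⁻¹ : ℝ) • Complex.exp (q.1 * Complex.I), q.2.1⁻¹ • q.2.2)

lemma lift_mem {t₀ : ℝ} {x : Ambient n} (hx : x ∈ quadric n) :
    lift t₀ x ∈ (coverClosure n).carrier := by
  have h0 : ‖x.1‖ ≠ 0 := norm_ne_zero_iff.2 (fst_ne_zero_of_mem_quadric hx)
  have h1 : Q n x = -1 := hx
  rw [Q_eq] at h1
  refine ⟨inv_nonneg.2 (norm_nonneg _), ?_⟩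
  simp only [lift, norm_smul, norm_inv, norm_norm]
  field_simp
  linarith

lemma unlift_mem_quadric {q : CoverAmbient n} (hq : q ∈ (coverClosure n).carrier)
    (hh : 0 < q.2.1) : unlift q ∈ quadric n := by
  change Q n (unlift q) = -1
  rw [Q_eq]
  simp only [unlift, norm_smul, norm_inv, Complex.norm_exp_ofReal_mul_I, Real.norm_eq_abs,
    abs_of_pos hh]
  field_simp
  linarith [hq.2]

lemma conformalMap_unlift {q : CoverAmbient n} (hh : 0 < q.2.1) :
    conformalMap n (unlift q) = coverProj n q := by
  have h1 : ‖(unlift q).1‖ = q.2.1⁻¹ := by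
    simp only [unlift, norm_smul, norm_inv, Complex.norm_exp_ofReal_mul_I, Real.norm_eq_abs,
      abs_of_pos hh, mul_one]
  have h0 : (q.2.1 : ℂ) ≠ 0 := by exact_mod_cast hh.ne'
  refine Prod.ext ?_ (Prod.ext ?_ ?_)
  · simp only [conformalMap, h1, coverProj]
    simp only [unlift, Complex.real_smul]
    push_cast
    field_simp
  · simp only [conformalMap, h1, coverProj, inv_inv]
  · simp only [conformalMap, h1, coverProj, inv_inv]
    simp only [unlift, smul_smul, mul_inv_cancel₀ hh.ne', one_smul]

lemma unlift_lift {t₀ : ℝ} {x : Ambient n} (hx : x ∈ quadric n) : unlift (lift t₀ x) = x := by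
  have h0 : ‖x.1‖ ≠ 0 := norm_ne_zero_iff.2 (fst_ne_zero_of_mem_quadric hx)
  refine Prod.ext ?_ ?_
  · simp only [unlift, lift, inv_inv, Complex.real_smul]
    set w := x.1 * Complex.exp (-(t₀ * Complex.I)) with hw
    have hn : ‖w‖ = ‖x.1‖ := by
      rw [hw, norm_mul, ← neg_mul, ← Complex.ofReal_neg, Complex.norm_exp_ofReal_mul_I, mul_one]
    rw [Complex.ofReal_add, add_mul, Complex.exp_add, mul_left_comm, ← hn,
      Complex.norm_mul_exp_arg_mul_I, hw, mul_left_comm, ← Complex.exp_add, add_neg_cancel,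
      Complex.exp_zero, mul_one]
  · simp only [unlift, lift, inv_inv, smul_smul, mul_inv_cancel₀ h0, one_smul]

section Lift

variable {L : Set (CoverAmbient n)} {p₀ : CoverAmbient n}

/-- On the regular domain the lift around the time of a point of `L` takes values in the invisible
domain, and it is there away from the cut of the argument. -/
lemma lift_mem_invisibleDomain (hL : L ⊆ (coverBoundary n).carrier) (hp₀ : p₀ ∈ L)
    {x : Ambient n} (hx : x ∈ (regularDomain n L).carrier) :
    lift p₀.1 x ∈ invisibleDomain n L ∧
      x.1 * Complex.exp (-(p₀.1 * Complex.I)) ∈ Complex.slitPlane := by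
  obtain ⟨hxQ, q, hq, hqx⟩ := hx
  have hz := fst_ne_zero_of_mem_quadric hxQ
  have hz0 : 0 < ‖x.1‖ := norm_pos_iff.2 hz
  have h1 : Complex.exp (q.1 * Complex.I) = x.1 / (‖x.1‖ : ℂ) := congrArg Prod.fst hqx
  have h2 : q.2 = (‖x.1‖⁻¹, ‖x.1‖⁻¹ • x.2) := congrArg Prod.snd hqx
  have hh : 0 < q.2.1 := by rw [h2]; exact inv_pos.2 hz0
  have hd := (mem_invisibleDomain_iff hL hq.1 hh).1 hq p₀ hp₀
  obtain ⟨hl, hu⟩ := abs_lt.1 (hd.trans (sphereDist_lt_pi hq.1 hh (hL hp₀).2))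
  have hw : x.1 * Complex.exp (-(p₀.1 * Complex.I)) =
      (‖x.1‖ : ℂ) * Complex.exp ((q.1 - p₀.1 : ℝ) * Complex.I) := by
    have h3 : x.1 = (‖x.1‖ : ℂ) * Complex.exp (q.1 * Complex.I) := by
      rw [h1, mul_div_cancel₀]
      exact_mod_cast hz0.ne'
    conv_lhs => rw [h3]
    rw [mul_assoc, ← Complex.exp_add]
    push_cast
    ring_nf
  have harg : Complex.arg (x.1 * Complex.exp (-(p₀.1 * Complex.I))) = q.1 - p₀.1 := by
    rw [hw, Complex.arg_real_mul _ hz0, Complex.arg_exp_mul_I, toIocMod_eq_self]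
    constructor <;> linarith
  constructor
  · have : lift p₀.1 x = q := by
      refine Prod.ext ?_ h2.symm
      simp only [lift, harg]
      ring
    rwa [this]
  · rw [Complex.mem_slitPlane_iff_arg, harg]
    exact ⟨hu.ne, mul_ne_zero hz (Complex.exp_ne_zero _)⟩

lemma lift_height_pos {t₀ : ℝ} {x : Ambient n} (hx : x ∈ quadric n) : 0 < (lift t₀ x).2.1 :=
  inv_pos.2 (norm_pos_iff.2 (fst_ne_zero_of_mem_quadric hx))

lemma contDiffAt_lift {t₀ : ℝ} {x : Ambient n}
    (hx : x.1 * Complex.exp (-(t₀ * Complex.I)) ∈ Complex.slitPlane) :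
    ContDiffAt ℝ 1 (lift t₀ : Ambient n → CoverAmbient n) x := by
  have hz : x.1 ≠ 0 := left_ne_zero_of_mul (Complex.slitPlane_ne_zero hx)
  have hn : ContDiffAt ℝ 1 (fun x : Ambient n => ‖x.1‖⁻¹) x :=
    (contDiffAt_fst.norm ℝ hz).inv (norm_ne_zero_iff.2 hz)
  refine ContDiffAt.prodMk ?_ (hn.prodMk (hn.smul contDiffAt_snd))
  refine contDiffAt_const.add ?_
  have h1 : ContDiffAt ℝ 1 (fun x : Ambient n =>
      Complex.log (x.1 * Complex.exp (-(t₀ * Complex.I)))) x :=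
    ((Complex.contDiffAt_log (n := 1) hx).restrict_scalars ℝ).comp x
      (contDiffAt_fst.mul contDiffAt_const)
  simpa only [Function.comp_def, Complex.imCLM_apply, Complex.log_im] using
    Complex.imCLM.contDiff.contDiffAt.comp x h1

/-- The conformal identification of the metrics: if `ρ = |z|` along a curve of the quadric then
`ρ ρ' + i ρ² T'` is `z̄ z'`, while `⟨y, y'⟩ = ρ ρ'`. -/
lemma exists_hasDerivAt_lift {t₀ : ℝ} {c : ℝ → Ambient n} {v : Ambient n} {s : ℝ}
    (hc : ∀ᶠ u in 𝓝 s, c u ∈ quadric n)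
    (hs : (c s).1 * Complex.exp (-(t₀ * Complex.I)) ∈ Complex.slitPlane)
    (hv : HasDerivAt c v s) :
    ∃ v', HasDerivAt (fun u => lift t₀ (c u)) v' s ∧
      ‖(c s).1‖ ^ 2 * v'.1 = (starRingEnd ℂ (c s).1 * v.1).im ∧
      ‖(c s).1‖ ^ 2 * productMetric n (lift t₀ (c s)) v' = Q n v := by
  have hx := hc.self_of_nhds
  have hz := fst_ne_zero_of_mem_quadric hx
  have hρ0 : 0 < ‖(c s).1‖ := norm_pos_iff.2 hz
  have hv1 : HasDerivAt (fun u => (c u).1) v.1 s := hv.fst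
  have hv2 : HasDerivAt (fun u => (c u).2) v.2 s := hv.snd
  obtain ⟨ρ', hρ⟩ : ∃ ρ', HasDerivAt (fun u => ‖(c u).1‖) ρ' s :=
    ⟨_, (hv1.differentiableAt.norm ℝ hz).hasDerivAt⟩
  have hre : ‖(c s).1‖ * ρ' = (starRingEnd ℂ (c s).1 * v.1).re := by
    have h1 := (hρ.pow 2).unique hv1.norm_sq
    rw [Complex.inner, mul_comm v.1] at h1
    norm_num at h1 ⊢
    linarith
  have hy : inner ℝ (c s).2 v.2 = ‖(c s).1‖ * ρ' := by
    have h1 : HasDerivAt (fun u => -‖(c u).1‖ ^ 2 + ‖(c u).2‖ ^ 2) 0 s :=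
      (hasDerivAt_const s (-1 : ℝ)).congr_of_eventuallyEq
        (hc.mono fun u hu => (Q_eq (c u)).symm.trans hu)
    have h2 := ((hρ.pow 2).neg.add hv2.norm_sq).unique h1
    norm_num at h2
    linarith
  have hT : HasDerivAt (fun u => t₀ + Complex.arg ((c u).1 * Complex.exp (-(t₀ * Complex.I))))
      (v.1 / (c s).1).im s := by
    have h1 := (hv1.mul_const (Complex.exp (-(t₀ * Complex.I)))).clog_real hs
    rw [mul_div_mul_right _ _ (Complex.exp_ne_zero _)] at h1
    simpa only [Function.comp_def, Complex.imCLM_apply, Complex.log_im] using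
      (Complex.imCLM.hasFDerivAt.comp_hasDerivAt s h1).const_add t₀
  have hh : HasDerivAt (fun u => ‖(c u).1‖⁻¹) (-ρ' / ‖(c s).1‖ ^ 2) s := hρ.inv hρ0.ne'
  have him : ‖(c s).1‖ ^ 2 * (v.1 / (c s).1).im = (starRingEnd ℂ (c s).1 * v.1).im := by
    rw [Complex.div_im, Complex.sq_norm]
    have : Complex.normSq (c s).1 ≠ 0 := by simpa using hz
    field_simp
    simp
    ring
  refine ⟨_, hT.prodMk (hh.prodMk (hh.smul hv2)), him, ?_⟩
  · have hsum : (‖(c s).1‖ * ρ') ^ 2 + (‖(c s).1‖ ^ 2 * (v.1 / (c s).1).im) ^ 2 =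
        ‖(c s).1‖ ^ 2 * ‖v.1‖ ^ 2 := by
      rw [hre, him, ← mul_pow, ← Complex.norm_conj (c s).1, ← norm_mul, Complex.sq_norm,
        Complex.normSq_apply]
      ring
    have hxQ : -‖(c s).1‖ ^ 2 + ‖(c s).2‖ ^ 2 = -1 := (Q_eq (c s)).symm.trans hx
    rw [Q_eq]
    simp only [productMetric]
    rw [norm_add_sq_real, real_inner_smul_left, real_inner_smul_right, real_inner_comm, norm_smul,
      norm_smul, mul_pow, mul_pow, Real.norm_eq_abs, Real.norm_eq_abs, sq_abs, sq_abs]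
    generalize (v.1 / (c s).1).im = a at *
    generalize ‖(c s).1‖ = ρ at *
    have hv1 : ‖v.1‖ ^ 2 = ρ' ^ 2 + ρ ^ 2 * a ^ 2 := by
      have h1 : ρ ^ 2 * (‖v.1‖ ^ 2 - (ρ' ^ 2 + ρ ^ 2 * a ^ 2)) = 0 := by linear_combination -hsum
      have h2 := (mul_eq_zero.1 h1).resolve_left (pow_ne_zero 2 hρ0.ne')
      linarith
    have hy2 : ‖(c s).2‖ ^ 2 = ρ ^ 2 - 1 := by linarith
    rw [hy, hy2, hv1]
    field_simp
    ring

end Lift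

end AdS

/-! ### Finiteness and limits of the lengths -/

/-- A function that decreases and is bounded below on `[0, ∞)` has a limit. -/
lemma AntitoneOn.exists_tendsto_atTop {f : ℝ → ℝ} (hf : AntitoneOn f (Ici 0)) {B : ℝ}
    (hB : ∀ s ∈ Ici (0 : ℝ), B ≤ f s) : ∃ l, Tendsto f atTop (𝓝 l) := by
  have hanti : Antitone fun s => f (max s 0) := fun a b hab =>
    hf (mem_Ici.2 (le_max_right _ _)) (mem_Ici.2 (le_max_right _ _)) (max_le_max_right 0 hab)
  refine ⟨_, (tendsto_atTop_ciInf hanti ⟨B, ?_⟩).congr' ?_⟩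
  · rintro _ ⟨s, rfl⟩
    exact hB _ (le_max_right s 0)
  · filter_upwards [eventually_ge_atTop 0] with s hs
    rw [max_eq_left hs]

namespace AdS

open EmbeddedSpacetime

variable {n : ℕ} {L : Set (CoverAmbient n)} {σ : ℝ} {p₀ : CoverAmbient n}

lemma mapsTo_lift {I : Set ℝ} {c : ℝ → Ambient n}
    {C : Ambient n → Ambient n → Prop} (hc : (regularDomain n L).IsCurve C I c) (t₀ : ℝ) :
    MapsTo (fun s => lift t₀ (c s)) I (coverClosure n).carrier :=
  fun _ hs => lift_mem (hc.mapsTo hs).1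

lemma not_signedCausal_regularDomain_zero (x : Ambient n) :
    ¬ (regularDomain n L).SignedCausal σ x 0 := by
  intro h
  simpa [regularDomain] using h.2

lemma ae_derivWithin_lift (hL : L ⊆ (coverBoundary n).carrier) (hp₀ : p₀ ∈ L) {I : Set ℝ}
    {c : ℝ → Ambient n}
    (hc : (regularDomain n L).IsCurve ((regularDomain n L).SignedCausal σ) I c) :
    ∀ᵐ s ∂(volume.restrict I),
      (coverClosure n).SignedCausal σ (lift p₀.1 (c s))
        (derivWithin (fun s => lift p₀.1 (c s)) I s) ∧
      √(-(regularDomain n L).metric (c s) (derivWithin c I s)) =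
        √(-productMetric n (lift p₀.1 (c s)) (derivWithin (fun s => lift p₀.1 (c s)) I s)) /
          (lift p₀.1 (c s)).2.1 := by
  filter_upwards [hc.ae_hasDerivAt not_signedCausal_regularDomain_zero] with s hs
  obtain ⟨hsI, hd, hm, ht⟩ := hs
  have hI : I ∈ 𝓝 s := mem_interior_iff_mem_nhds.1 hsI
  have hsI' := interior_subset hsI
  have hz := norm_pos_iff.2 (fst_ne_zero_of_mem_quadric (hc.mapsTo hsI').1)
  obtain ⟨v', hv', htime, hmet⟩ := exists_hasDerivAt_lift
    (mem_of_superset hI fun u hu => (hc.mapsTo hu).1)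
    (lift_mem_invisibleDomain hL hp₀ (hc.mapsTo hsI')).2 hd
  rw [hv'.hasDerivWithinAt.derivWithin (uniqueDiffWithinAt_of_mem_nhds hI)]
  have hm' : Q n (derivWithin c I s) ≤ 0 := hm
  have ht' : σ * (starRingEnd ℂ (c s).1 * (derivWithin c I s).1).im < 0 := ht
  rw [← hmet] at hm'
  rw [← htime] at ht'
  have hz2 : 0 < ‖(c s).1‖ ^ 2 := by positivity
  refine ⟨⟨?_, ?_⟩, ?_⟩
  · exact nonpos_of_mul_nonpos_right hm' hz2
  · rw [mul_left_comm] at ht'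
    exact neg_of_mul_neg_right ht' hz2.le
  · change √(-Q n (derivWithin c I s)) = _
    rw [← hmet, ← mul_neg, Real.sqrt_mul hz2.le, Real.sqrt_sq hz.le]
    simp only [lift, div_inv_eq_mul]
    ring

lemma isCurve_lift (hL : L ⊆ (coverBoundary n).carrier) (hp₀ : p₀ ∈ L) {I : Set ℝ}
    {c : ℝ → Ambient n}
    (hc : (regularDomain n L).IsCurve ((regularDomain n L).SignedCausal σ) I c) :
    (coverClosure n).IsCurve ((coverClosure n).SignedCausal σ) I (fun s => lift p₀.1 (c s)) where
  ordConnected := hc.ordConnected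
  mapsTo := mapsTo_lift hc _
  locallyLipschitz := hc.locallyLipschitz.comp_contDiffAt fun _ hs =>
    contDiffAt_lift (lift_mem_invisibleDomain hL hp₀ (hc.mapsTo hs)).2
  velocity := (ae_derivWithin_lift hL hp₀ hc).mono fun _ hs => hs.1

/-- The signed time difference between a point of the regular domain and a point of `L` is smaller
than their distance. -/
lemma abs_signed_time_sub_lt (hL : L ⊆ (coverBoundary n).carrier) (hσ : |σ| = 1) (hp₀ : p₀ ∈ L)
    {x : Ambient n} (hx : x ∈ (regularDomain n L).carrier) {p : CoverAmbient n} (hp : p ∈ L) :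
    |σ * (lift p₀.1 x).1 - σ * p.1| < sphereDist p (lift p₀.1 x) := by
  rw [← mul_sub, abs_mul, hσ, one_mul]
  exact (mem_invisibleDomain_iff hL (lift_mem hx.1) (lift_height_pos hx.1)).1
    (lift_mem_invisibleDomain hL hp₀ hx).1 p hp

/-- A point far from all points of a set that meets every vertical line of the boundary is high. -/
lemma sin_le_height (hL : ∀ y : Euc n, ‖y‖ = 1 → ∃ p ∈ L, p.2.2 = y) {q : CoverAmbient n}
    (hq : q ∈ (coverClosure n).carrier) {θ : ℝ} (hθ : θ ∈ Icc 0 (Real.pi / 2))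
    (hd : ∀ p ∈ L, θ ≤ sphereDist p q) : Real.sin θ ≤ q.2.1 := by
  have hsq : ‖q.2.2‖ ≤ Real.cos θ := by
    rcases eq_or_ne q.2.2 0 with h0 | h0
    · rw [h0, norm_zero]
      exact Real.cos_nonneg_of_neg_pi_div_two_le_of_le (by linarith [hθ.1, Real.pi_pos]) hθ.2
    · have hn := norm_ne_zero_iff.2 h0
      obtain ⟨p, hp, hpy⟩ := hL (‖q.2.2‖⁻¹ • q.2.2) (by
        rw [norm_smul, norm_inv, norm_norm, inv_mul_cancel₀ hn])
      have h1 := hd p hp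
      have h2 : inner ℝ q.2.2 p.2.2 = ‖q.2.2‖ := by
        rw [hpy, real_inner_smul_right, real_inner_self_eq_norm_sq, sq, ← mul_assoc,
          inv_mul_cancel₀ hn, one_mul]
      rw [sphereDist, h2] at h1
      have h3 := Real.cos_le_cos_of_nonneg_of_le_pi hθ.1 (Real.arccos_le_pi _) h1
      rwa [Real.cos_arccos (by linarith [norm_nonneg q.2.2]) (norm_le_one_of_mem_coverClosure hq)]
        at h3
  have h1 := Real.sin_sq_add_cos_sq θ
  have h2 := hq.2
  have h3 : ‖q.2.2‖ ^ 2 ≤ Real.cos θ ^ 2 := by gcongr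
  refine le_of_sq_le_sq (by linarith) hq.1

/-- The length bound for the causal curves from a point that is separated by a margin `η` from the
horizon opposite to their direction. The margin is kept along such a curve, so its height is at
least `sin (η / 2)`. The parameters `p ∈ L` and `ε > 0` are at disposal. -/
lemma length_le (hL : IsAchronalSphere n L) (hσ : |σ| = 1) (hp₀ : p₀ ∈ L) {x : Ambient n}
    {η : ℝ} (hη : 0 < η) (hη1 : η ≤ 1)
    (hx : ∀ p ∈ L, σ * (lift p₀.1 x).1 - sphereDist p (lift p₀.1 x) - σ * p.1 ≤ -η)
    {p : CoverAmbient n} (hp : p ∈ L) {ε : ℝ} (hε : 0 < ε) :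
    ⨆ γ ∈ (regularDomain n L).curvesFrom ((regularDomain n L).SignedCausal σ) x,
      (regularDomain n L).length γ.1 γ.2 ≤
    ENNReal.ofReal ((2 * Real.sin (η / 2))⁻¹ *
      (ε⁻¹ * (σ * (lift p₀.1 x).1 + sphereDist p (lift p₀.1 x) - σ * p.1) +
        2 * ε * (2 * Real.pi))) := by
  refine iSup₂_le ?_
  rintro ⟨I, c⟩ ⟨hI, hc, hc0⟩
  simp only at hI hc hc0
  have hLB := hL.1.1
  have hσ2 : σ ^ 2 = 1 := by rw [← sq_abs, hσ, one_pow]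
  have hγ := isCurve_lift hLB hp₀ hc
  have hE : ∀ s ∈ I, ∀ q ∈ L,
      |σ * (lift p₀.1 (c s)).1 - σ * q.1| < sphereDist q (lift p₀.1 (c s)) :=
    fun s hs q hq => abs_signed_time_sub_lt hLB hσ hp₀ (hc.mapsTo hs) hq
  have hlen : (regularDomain n L).length I c =
      ∫⁻ s in I, ENNReal.ofReal (√(-productMetric n (lift p₀.1 (c s))
        (derivWithin (fun s => lift p₀.1 (c s)) I s)) / (lift p₀.1 (c s)).2.1) := by
    refine lintegral_congr_ae ?_
    filter_upwards [ae_derivWithin_lift hLB hp₀ hc] with s hs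
    rw [hs.2]
  rw [hlen]
  have hsin : 0 < Real.sin (η / 2) :=
    Real.sin_pos_of_pos_of_lt_pi (by linarith) (by linarith [Real.pi_gt_three])
  refine lintegral_speed_le hσ2 hγ hI (hLB hp).2 hsin (fun s hs => ?_) hε (fun s hs => ?_)
    fun s hs => ?_
  · refine sin_le_height (fun y hy => hL.exists_mem hy) (hγ.mapsTo hs)
      ⟨by linarith, by linarith [Real.pi_gt_three]⟩ fun q hq => ?_
    have h1 := antitoneOn_signed_time_add_sphereDist hσ2 hγ (k := -1) (by simp) (hLB hq).2
      hI.1 hs (hI.2 hs)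
    have h2 := hx q hq
    have h3 := (abs_lt.1 (hE s hs q hq)).1
    simp only [hc0] at h1
    linarith
  · have h3 := (abs_lt.1 (hE s hs p hp)).1
    simp only [hc0]
    linarith
  · have h1 := abs_lt.1 (hE s hs p₀ hp₀)
    have h2 := abs_lt.1 (hE 0 hI.1 p₀ hp₀)
    have h3 : ∀ q : CoverAmbient n, sphereDist p₀ q ≤ Real.pi := fun q => Real.arccos_le_pi _
    have h4 := h3 (lift p₀.1 (c s))
    have h5 := h3 (lift p₀.1 (c 0))
    linarith

/-- Since `L` is compact, a point of the regular domain is separated from it by a margin. -/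
lemma exists_margin (hL : IsAchronalSphere n L) (hσ : |σ| = 1) (hp₀ : p₀ ∈ L) {x : Ambient n}
    (hx : x ∈ (regularDomain n L).carrier) :
    ∃ η, 0 < η ∧ η ≤ 1 ∧
      ∀ p ∈ L, σ * (lift p₀.1 x).1 - sphereDist p (lift p₀.1 x) - σ * p.1 ≤ -η := by
  have hcont : Continuous fun p : CoverAmbient n =>
      σ * (lift p₀.1 x).1 - sphereDist p (lift p₀.1 x) - σ * p.1 := by
    have : Continuous fun p : CoverAmbient n => sphereDist p (lift p₀.1 x) :=
      Real.continuous_arccos.comp (by fun_prop)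
    fun_prop
  obtain ⟨q, hq, hmax⟩ := hL.isCompact.exists_isMaxOn ⟨p₀, hp₀⟩ hcont.continuousOn
  have hneg := (abs_lt.1 (abs_signed_time_sub_lt hL.1.1 hσ hp₀ hx hq)).2
  refine ⟨min 1 (-(σ * (lift p₀.1 x).1 - sphereDist q (lift p₀.1 x) - σ * q.1)),
    lt_min one_pos (by linarith), min_le_left _ _, fun p hp => ?_⟩
  have h1 := hmax hp
  have h2 := min_le_right 1 (-(σ * (lift p₀.1 x).1 - sphereDist q (lift p₀.1 x) - σ * q.1))
  simp only [mem_ofPred_eq] at h1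
  linarith

/-- In the universal cover a causal curve of the regular domain has an endpoint: its time is
monotone and bounded, hence so are its time plus its distance to any boundary point, and these
distances determine the coordinates in the hemisphere. -/
lemma exists_tendsto_lift (hL : IsAchronalSphere n L) (hσ : |σ| = 1) (hp₀ : p₀ ∈ L)
    {c : ℝ → Ambient n}
    (hc : (regularDomain n L).IsCurve ((regularDomain n L).SignedCausal σ) (Ici 0) c) :
    ∃ q : CoverAmbient n, Tendsto (fun s => lift p₀.1 (c s)) atTop (𝓝 q) := by
  have hLB := hL.1.1
  have hσ2 : σ ^ 2 = 1 := by rw [← sq_abs, hσ, one_pow]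
  have hγ := isCurve_lift hLB hp₀ hc
  have hpi : ∀ p q : CoverAmbient n, sphereDist p q ≤ Real.pi := fun p q => Real.arccos_le_pi _
  have hpi0 : ∀ p q : CoverAmbient n, 0 ≤ sphereDist p q := fun p q => Real.arccos_nonneg _
  have hbdd : ∀ s ∈ Ici (0 : ℝ), σ * p₀.1 - Real.pi ≤ σ * (lift p₀.1 (c s)).1 := by
    intro s hs
    have h1 := (abs_lt.1 (abs_signed_time_sub_lt hLB hσ hp₀ (hc.mapsTo hs) hp₀)).1
    linarith [hpi p₀ (lift p₀.1 (c s))]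
  obtain ⟨S, hS⟩ : ∃ S, Tendsto (fun s => σ * (lift p₀.1 (c s)).1) atTop (𝓝 S) := by
    refine AntitoneOn.exists_tendsto_atTop ?_ hbdd
    simpa using antitoneOn_signed_time_add_sphereDist hσ2 hγ (k := 0) (by simp) (hLB hp₀).2
  have hT : Tendsto (fun s => (lift p₀.1 (c s)).1) atTop (𝓝 (σ * S)) := by
    refine (hS.const_mul σ).congr fun s => ?_
    rw [← mul_assoc, ← sq, hσ2, one_mul]
  have hw : ∀ y : Euc n, ‖y‖ = 1 →
      ∃ w, Tendsto (fun s => inner ℝ (lift p₀.1 (c s)).2.2 y) atTop (𝓝 w) := by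
    intro y hy
    obtain ⟨U, hU⟩ := (antitoneOn_signed_time_add_sphereDist hσ2 hγ (k := 1) (p := (0, 0, y))
      (by simp) hy).exists_tendsto_atTop (B := σ * p₀.1 - Real.pi) fun s hs => by
        have h1 := hbdd s hs
        have h2 := hpi0 (0, 0, y) (lift p₀.1 (c s))
        linarith
    have hD := (Real.continuous_cos.tendsto _).comp (hU.sub hS)
    refine ⟨_, hD.congr' ?_⟩
    filter_upwards [eventually_ge_atTop 0] with s hs
    have h1 := abs_real_inner_le_norm (lift p₀.1 (c s)).2.2 y
    rw [hy, mul_one] at h1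
    obtain ⟨h2, h3⟩ := abs_le.1 (h1.trans (norm_le_one_of_mem_coverClosure (hγ.mapsTo hs)))
    simp only [Function.comp_apply, one_mul, add_sub_cancel_left, sphereDist]
    exact Real.cos_arccos h2 h3
  choose w hw using fun i : Fin (n - 1) => hw (EuclideanSpace.single i 1) (by simp)
  have hY : Tendsto (fun s => (lift p₀.1 (c s)).2.2) atTop (𝓝 (WithLp.toLp 2 w)) := by
    have h1 : Tendsto (fun s => WithLp.ofLp (lift p₀.1 (c s)).2.2) atTop (𝓝 w) := by
      rw [tendsto_pi_nhds]
      intro i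
      simpa [EuclideanSpace.inner_single_right] using hw i
    exact ((PiLp.continuous_toLp 2 _).tendsto w).comp h1
  have hh : Tendsto (fun s => (lift p₀.1 (c s)).2.1) atTop
      (𝓝 (√(1 - ‖(WithLp.toLp 2 w : Euc n)‖ ^ 2))) := by
    refine ((Real.continuous_sqrt.tendsto _).comp ((hY.norm.pow 2).const_sub 1)).congr' ?_
    filter_upwards [eventually_ge_atTop 0] with s hs
    have h1 := hγ.mapsTo hs
    rw [Function.comp_apply, ← h1.2, add_sub_cancel_right, Real.sqrt_sq h1.1]
  exact ⟨_, hT.prodMk_nhds (hh.prodMk_nhds hY)⟩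

lemma continuousAt_unlift {q : CoverAmbient n} (hq : q.2.1 ≠ 0) : ContinuousAt unlift q := by
  have h1 : ContinuousAt (fun q : CoverAmbient n => q.2.1⁻¹) q :=
    (continuous_fst.comp continuous_snd).continuousAt.inv₀ hq
  refine (h1.smul ?_).prodMk (h1.smul (continuous_snd.comp continuous_snd).continuousAt)
  exact Continuous.continuousAt (by fun_prop)

lemma isClosed_coverClosure_carrier : IsClosed (coverClosure n).carrier :=
  (isClosed_le (f := fun _ : CoverAmbient n => (0 : ℝ)) (g := fun x => x.2.1) (by fun_prop)
    (by fun_prop)).inter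
    (isClosed_eq (f := fun x : CoverAmbient n => x.2.1 ^ 2 + ‖x.2.2‖ ^ 2) (g := fun _ => 1)
      (by fun_prop) (by fun_prop))

/-- The supremum of lengths of past (`σ = 1`) or future (`σ = -1`) causal curves is finite and tends
to `0` along inextendible ones. Such a curve ends, in the cover, at an interior point `q` outside
the invisible domain, so that `σ t + d(·, p) - σ t(p)` tends to `0` along it for some `p ∈ L`. -/
theorem regular_of_signedCausal (hn : 2 ≤ n) (hL : IsAchronalSphere n L) (hσ : |σ| = 1) :
    (∀ x ∈ (regularDomain n L).carrier,
      ⨆ γ ∈ (regularDomain n L).curvesFrom ((regularDomain n L).SignedCausal σ) x,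
        (regularDomain n L).length γ.1 γ.2 < ∞) ∧
    ∀ c : ℝ → Ambient n,
      (regularDomain n L).IsInextendible ((regularDomain n L).SignedCausal σ) c →
      Tendsto (fun s => ⨆ γ ∈ (regularDomain n L).curvesFrom
        ((regularDomain n L).SignedCausal σ) (c s), (regularDomain n L).length γ.1 γ.2)
        atTop (𝓝 0) := by
  obtain ⟨p₀, hp₀, -⟩ := hL.exists_mem (y := EuclideanSpace.single ⟨0, by omega⟩ 1) (by simp)
  have hLB := hL.1.1
  have hσ2 : σ ^ 2 = 1 := by rw [← sq_abs, hσ, one_pow]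
  refine ⟨fun x hx => ?_, fun c ⟨hc, hinext⟩ => ?_⟩
  · obtain ⟨η, hη, hη1, hxη⟩ := exists_margin hL hσ hp₀ hx
    exact (length_le hL hσ hp₀ hη hη1 hxη hp₀ one_pos).trans_lt ENNReal.ofReal_lt_top
  have h0 : (0 : ℝ) ∈ Ici (0 : ℝ) := mem_Ici.2 le_rfl
  obtain ⟨η, hη, hη1, hη0⟩ := exists_margin hL hσ hp₀ (hc.mapsTo h0)
  have hγ := isCurve_lift hLB hp₀ hc
  -- the margin persists along the curve
  have hmargin : ∀ s ∈ Ici (0 : ℝ), ∀ p ∈ L,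
      σ * (lift p₀.1 (c s)).1 - sphereDist p (lift p₀.1 (c s)) - σ * p.1 ≤ -η := by
    intro s hs p hp
    have h1 := antitoneOn_signed_time_add_sphereDist hσ2 hγ (k := -1) (by simp) (hLB hp).2
      h0 hs hs
    have h2 := hη0 p hp
    simp only at h1
    linarith
  have hheight : ∀ s ∈ Ici (0 : ℝ), Real.sin (η / 2) ≤ (lift p₀.1 (c s)).2.1 := by
    intro s hs
    refine sin_le_height (fun y hy => hL.exists_mem hy) (hγ.mapsTo hs)
      ⟨by linarith, by linarith [Real.pi_gt_three]⟩ fun p hp => ?_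
    have h1 := (abs_lt.1 (abs_signed_time_sub_lt hLB hσ hp₀ (hc.mapsTo hs) hp)).1
    have h2 := hmargin s hs p hp
    linarith
  have hsin : 0 < Real.sin (η / 2) :=
    Real.sin_pos_of_pos_of_lt_pi (by linarith) (by linarith [Real.pi_gt_three])
  obtain ⟨q, hq⟩ := exists_tendsto_lift hL hσ hp₀ hc
  have hev : ∀ᶠ s in atTop, s ∈ Ici (0 : ℝ) := eventually_ge_atTop 0
  have hqc : q ∈ (coverClosure n).carrier :=
    isClosed_coverClosure_carrier.mem_of_tendsto hq (hev.mono fun s hs => hγ.mapsTo hs)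
  have hqh : 0 < q.2.1 :=
    hsin.trans_le (ge_of_tendsto hq.snd_nhds.fst_nhds (hev.mono fun s hs => hheight s hs))
  have hcq : Tendsto c atTop (𝓝 (unlift q)) := by
    refine ((continuousAt_unlift hqh.ne').tendsto.comp hq).congr' ?_
    filter_upwards [hev] with s hs
    exact unlift_lift (hc.mapsTo hs).1
  obtain ⟨p, hp, hpq⟩ : ∃ p ∈ L, sphereDist p q ≤ |q.1 - p.1| := by
    by_contra! hall
    refine hinext ⟨unlift q, ⟨unlift_mem_quadric hqc hqh, q, ?_, ?_⟩, hcq⟩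
    · exact (mem_invisibleDomain_iff hLB hqc hqh).2 hall
    · exact (conformalMap_unlift hqh).symm
  have hSlim : Tendsto (fun s => σ * (lift p₀.1 (c s)).1) atTop (𝓝 (σ * q.1)) :=
    hq.fst_nhds.const_mul σ
  have hDlim : Tendsto (fun s => sphereDist p (lift p₀.1 (c s))) atTop (𝓝 (sphereDist p q)) :=
    ((continuous_sphereDist p).tendsto q).comp hq
  have hUlim := (hSlim.add hDlim).sub_const (σ * p.1)
  have hVq : σ * q.1 - sphereDist p q - σ * p.1 ≤ -η :=
    le_of_tendsto ((hSlim.sub hDlim).sub_const (σ * p.1)) (hev.mono fun s hs => hmargin s hs p hp)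
  have hUq : σ * q.1 + sphereDist p q - σ * p.1 ≤ 0 := by
    have h1 : |q.1 - p.1| = |σ * q.1 - σ * p.1| := by rw [← mul_sub, abs_mul, hσ, one_mul]
    rw [h1] at hpq
    rcases le_abs.1 hpq with h | h <;> linarith
  refine ENNReal.tendsto_nhds_zero.2 fun e he => ?_
  -- the parameter `ε` of the length bound is chosen before the point of the curve
  have hεlim : Tendsto (fun ε : ℝ => ENNReal.ofReal ((2 * Real.sin (η / 2))⁻¹ *
      (2 * ε * (2 * Real.pi)))) (𝓝[>] 0) (𝓝 0) := by
    have h1 : Continuous fun ε : ℝ => ENNReal.ofReal ((2 * Real.sin (η / 2))⁻¹ *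
        (2 * ε * (2 * Real.pi))) := ENNReal.continuous_ofReal.comp (by fun_prop)
    simpa using (h1.tendsto 0).mono_left nhdsWithin_le_nhds
  obtain ⟨ε, hεe, hε⟩ := ((hεlim.eventually_lt_const he).and self_mem_nhdsWithin).exists
  have hε0 : 0 < ε := hε
  have hbound : Tendsto (fun s => ENNReal.ofReal ((2 * Real.sin (η / 2))⁻¹ *
      (ε⁻¹ * (σ * (lift p₀.1 (c s)).1 + sphereDist p (lift p₀.1 (c s)) - σ * p.1) +
        2 * ε * (2 * Real.pi)))) atTop (𝓝 (ENNReal.ofReal ((2 * Real.sin (η / 2))⁻¹ *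
      (ε⁻¹ * (σ * q.1 + sphereDist p q - σ * p.1) + 2 * ε * (2 * Real.pi))))) :=
    ENNReal.tendsto_ofReal (((hUlim.const_mul ε⁻¹).add_const _).const_mul _)
  have hlt : ENNReal.ofReal ((2 * Real.sin (η / 2))⁻¹ *
      (ε⁻¹ * (σ * q.1 + sphereDist p q - σ * p.1) + 2 * ε * (2 * Real.pi))) < e := by
    refine (ENNReal.ofReal_le_ofReal ?_).trans_lt hεe
    have h1 : ε⁻¹ * (σ * q.1 + sphereDist p q - σ * p.1) ≤ 0 :=
      mul_nonpos_of_nonneg_of_nonpos (inv_pos.2 hε0).le hUq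
    gcongr
    linarith
  filter_upwards [hbound.eventually_lt_const hlt, hev] with s hs hs0
  exact (length_le hL hσ hp₀ hη hη1 (hmargin s hs0) hp hε0).trans hs.le

end AdS

end

theorem mainTheorem9 (n : ℕ) (hn : 2 ≤ n) (L : Set (AdS.CoverAmbient n))
    (hL : AdS.IsAchronalSphere n L) :
    (AdS.regularDomain n L).HasRegularCosmologicalTime ∧
      (AdS.regularDomain n L).HasRegularReverseCosmologicalTime := by
  have h1 := AdS.regular_of_signedCausal (σ := 1) hn hL (by simp)
  have h2 := AdS.regular_of_signedCausal (σ := -1) hn hL (by simp)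
  rw [EmbeddedSpacetime.signedCausal_one] at h1
  rw [EmbeddedSpacetime.signedCausal_neg_one] at h2
  exact ⟨h1, h2⟩
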